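/- Let $n\ge m\ge 1$ and let $\mathbf H=[\mathbf h_1,\dots,\mathbf h_m]$ be a random $n\times m$ matrix whose entries are i.i.d. circularly symmetric complex Gaussian with zero mean and unit variance (i.i.d. Rayleigh fading). Stream $i$ of the coded zero-forcing V-BLAST with power allocation $\boldsymbol\alpha=(\alpha_1,\dots,\alpha_m)$ at average SNR $\gamma_0$ has the instantaneous capacity $C_i=\ln(1+\alpha_i g_i\gamma_0)$, where $g_i=|\mathbf h_{i\perp}|^2$ and $\mathbf h_{i\perp}$ is the projection of $\mathbf h_i$ onto the orthogonal complement of the span of the columns $\mathbf h_j$, $j>i$, of the yet-to-be-detected streams. Each stream uses a capacity-achieving code with the rate equal to its mean capacity $\mathbb E\,C_i$ (which is finite), so that the total mean (ergodic) capacity is $\overline C(\boldsymbol\alpha)=\sum_{i=1}^m\mathbb E\,C_i$. Consider its maximization over all $\boldsymbol\alpha=\boldsymbol\alpha(\gamma_0)$ with $\alpha_i\ge 0$ and $\sum_{i=1}^m\alpha_i=m$. For all sufficiently large $\gamma_0$ the maximizer exists and is unique (and it is the same whether the span in the definition of $\mathbf h_{i\perp}$ runs over all $j>i$, or only over those $j>i$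 that are not turned off, $\alpha_j>0$), and it is $$\alpha_i=\frac{1-\frac{A_i}{\gamma_0}}{1-\frac{1}{m\gamma_0}\sum_{j=1}^m A_j},\qquad i=1,\dots,m,$$ where, as $\gamma_0\to\infty$, the coefficients $A_i=A_i(\gamma_0)$ satisfy $A_i-\hat A_i\to 0$ with $$\hat A_i=\begin{cases}\ln\gamma_0-\mathcal E, & i=1-n+m,\\ \dfrac{1}{n-m+i-1}, & i>1-n+m,\end{cases}$$ and $\mathcal E\approx 0.577$ is Euler's constant. Consequently, the formula with $\hat A_i$ in place of $A_i$ gives the optimal $\alpha_i$ up to an error $o(1/\gamma_0)$. Hence the uniform allocation is asymptotically optimal: as $\gamma_0\to\infty$, the optimal $\alpha_i$ tend to $1$, and $\max_{\boldsymbol\alpha}\overline C(\boldsymbol\alpha)-\overline C(1,\dots,1)\to 0$. -/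

import Mathlib

open Real Set Filter Topology MeasureTheory ProbabilityTheory Asymptotics

noncomputable section

namespace VBlast

/-- The circularly symmetric complex Gaussian law with zero mean and unit variance `𝔼|h|² = 1`:
independent real and imaginary parts, each `𝒩(0, 1/2)`. -/
def complexGaussian : Measure ℂ :=
  ((gaussianReal 0 (1 / 2)).prod (gaussianReal 0 (1 / 2))).map (fun p : ℝ × ℝ => (⟨p.1, p.2⟩ : ℂ))

/-- I.i.d. Rayleigh fading: the entries of the random channel matrix are independent, and each is
circularly symmetric complex Gaussian with unit variance. -/
structure IsIIDRayleigh {Ω : Type*} [MeasurableSpace Ω] {n m : ℕ} (P : Measure Ω)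
    (H : Ω → Matrix (Fin n) (Fin m) ℂ) : Prop where
  law : ∀ a i, HasLaw (fun ω => H ω a i) complexGaussian P
  indep : iIndepFun (fun (p : Fin n × Fin m) ω => H ω p.1 p.2) P

variable {n m : ℕ}

/-- The `i`-th column `hᵢ` of the channel matrix, as a vector of the Hermitian space `ℂⁿ`. -/
def column (H : Matrix (Fin n) (Fin m) ℂ) (i : Fin m) : EuclideanSpace ℂ (Fin n) :=
  WithLp.toLp 2 (fun a => H a i)

/-- The span of the columns of those streams `j ∈ S` that are yet to be detected when stream `i`
is detected (the streams are detected in the order of their indices). -/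
def interference (H : Matrix (Fin n) (Fin m) ℂ) (S : Set (Fin m)) (i : Fin m) :
    Submodule ℂ (EuclideanSpace ℂ (Fin n)) :=
  Submodule.span ℂ (column H '' {j | i < j ∧ j ∈ S})

/-- The gain `gᵢ = ‖hᵢ⊥‖²` of stream `i` after zero forcing, where `hᵢ⊥` is the orthogonal
projection of `hᵢ` onto the orthogonal complement of the interference from the streams in `S`. -/
def gain (H : Matrix (Fin n) (Fin m) ℂ) (S : Set (Fin m)) (i : Fin m) : ℝ :=
  ‖(interference H S i)ᗮ.starProjection (column H i)‖ ^ 2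

/-- The instantaneous capacity (in nats) `Cᵢ = ln (1 + αᵢ gᵢ γ₀)` of stream `i`. -/
def streamCapacity (H : Matrix (Fin n) (Fin m) ℂ) (S : Set (Fin m)) (γ₀ : ℝ) (α : Fin m → ℝ)
    (i : Fin m) : ℝ :=
  Real.log (1 + α i * gain H S i * γ₀)

/-- All streams. -/
def allStreams (_ : Fin m → ℝ) : Set (Fin m) := Set.univ

/-- The streams that are not turned off by the power allocation `α`. -/
def activeStreams (α : Fin m → ℝ) : Set (Fin m) := {j | 0 < α j}

/-- The total mean (ergodic) capacity `C̄(α) = ∑ᵢ 𝔼 Cᵢ`, as a function of the power allocation `α`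
and the average SNR `γ₀`.  Here `N α` is the set of the streams whose interference the receiver
nulls out: either all streams (`allStreams`), or only those with non-zero power
(`activeStreams`). -/
def meanCapacity {Ω : Type*} [MeasurableSpace Ω] (P : Measure Ω)
    (H : Ω → Matrix (Fin n) (Fin m) ℂ) (N : (Fin m → ℝ) → Set (Fin m)) (γ₀ : ℝ)
    (α : Fin m → ℝ) : ℝ :=
  ∑ i, ∫ ω, streamCapacity (H ω) (N α) γ₀ α i ∂P

/-- The power allocations that satisfy the total power constraint. -/
def allocations (m : ℕ) : Set (Fin m → ℝ) :=
  {α | (∀ i, 0 ≤ α i) ∧ ∑ i, α i = m}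

/-- `α` maximises the total mean capacity under the total power constraint. -/
def IsOptimal {Ω : Type*} [MeasurableSpace Ω] (P : Measure Ω)
    (H : Ω → Matrix (Fin n) (Fin m) ℂ) (N : (Fin m → ℝ) → Set (Fin m)) (γ₀ : ℝ)
    (α : Fin m → ℝ) : Prop :=
  α ∈ allocations m ∧ IsMaxOn (meanCapacity P H N γ₀) (allocations m) α

/-- The allocation `αᵢ = (1 - Aᵢ/γ₀) / (1 - (1/(m γ₀)) ∑ⱼ Aⱼ)`. -/
def allocationFormula (γ₀ : ℝ) (A : Fin m → ℝ) (i : Fin m) : ℝ :=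
  (1 - A i / γ₀) / (1 - 1 / (m * γ₀) * ∑ j, A j)

/-- The high-SNR values of the coefficients.  The streams are numbered from `0` here, so `i` stands
for the stream number `i + 1`, which has `n - m + (i + 1)` degrees of freedom. -/
def approxCoeff (n : ℕ) (γ₀ : ℝ) (i : Fin m) : ℝ :=
  if n + ((i : ℕ) + 1) = m + 1 then Real.log γ₀ - Real.eulerMascheroniConstant
  else 1 / ((n : ℝ) - m + ((i : ℕ) + 1) - 1)

end VBlast

end

/-!
The gain of stream `i` (numbered from `0`) is the squared length of the projection of a complex
Gaussian vector to the orthogonal complement of an independent random subspace, which almost surely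
has dimension `m - 1 - i`. So it has the Laplace transform `(1 + s)⁻ᵈ` of the Gamma law with
`d = n - m + i + 1` degrees of freedom (`IsIIDRayleigh.integral_exp_neg_gain`). Integrating this
transform over `s` gives the mean `φ t = 𝔼 (1 + t g)⁻¹` of the gain `g` in the form
`∫₀^∞ e⁻ᵘ (1 + t u)⁻ᵈ du`, and hence `t φ t → 1 / (d - 1)` for `d ≥ 2` and
`t φ t - log t → -ℰ` for `d = 1`; the latter rests on `∫₀^∞ (log u) e⁻ᵘ du = Γ'(1) = -ℰ`.

For fixed gains the mean capacity is continuous and strictly concave in the powers, so that it has a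
unique maximizer on the compact set of allocations. At high SNR `γ` all its powers are positive, and
the marginal capacities `𝔼 (gᵢ γ / (1 + αᵢ gᵢ γ)) = (1 - φᵢ (αᵢ γ)) / αᵢ` of all streams agree.
Together with the power constraint this is exactly the allocation formula with the coefficients
`Aᵢ = γ φᵢ (αᵢ γ)`. Moreover `αᵢ γ → ∞`, so `αᵢ → 1`, faster than `1 / log γ`, and the asymptotics of
`φᵢ` give those of `Aᵢ` (`tendsto_exactCoeff_sub`). All the concavity and first-order conditions come
from the tangent line inequality of the logarithm; no integral is differentiated.

If the gains are recomputed when streams are turned off, an allocation with a zero power has a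
capacity of at most `(m - 1) log γ + O(1)`, whereas the uniform allocation has at least
`(m - 1/2) log γ` by Jensen's inequality, so at high SNR only allocations without zeros compete
(`IsIIDRayleigh.eventually_meanCapacity_lt`), and for them both notions of gain coincide.
-/

noncomputable section

/-! ### Inverse means of Gamma laws -/

namespace VBlast

theorem integrableOn_log_mul_exp_neg :
    IntegrableOn (fun u : ℝ => Real.log u * Real.exp (-u)) (Ioi 0) := by
  have h := (mellin_hasDerivAt_of_isBigO_rpow (E := ℂ) (a := 2) (b := 0) (s := 1)
    (f := fun x : ℝ => ((Real.exp (-x) : ℝ) : ℂ)) ?_ ?_ (by norm_num) ?_ (by norm_num)).1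
  · rw [MellinConvergent] at h
    have := h.re
    refine this.congr (.of_forall fun x => ?_)
    simp [-Complex.ofReal_exp]
  · refine (Continuous.continuousOn ?_).locallyIntegrableOn measurableSet_Ioi
    fun_prop
  · rw [← isBigO_norm_left]
    simp_rw [Complex.norm_real, isBigO_norm_left]
    simpa only [neg_one_mul] using (isLittleO_exp_neg_mul_rpow_atTop zero_lt_one _).isBigO
  · simp_rw [neg_zero, rpow_zero]
    refine isBigO_const_of_tendsto (?_ : Tendsto _ _ (𝓝 (1 : ℂ))) one_ne_zero
    rw [(by simp : (1 : ℂ) = ((Real.exp (-0) : ℝ) : ℂ))]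
    have : Continuous fun x : ℝ => ((Real.exp (-x) : ℝ) : ℂ) := by fun_prop
    exact (this.tendsto 0).mono_left inf_le_left

/-- This integral is the derivative of the Gamma function at `1`. -/
theorem integral_log_mul_exp_neg :
    ∫ u in Ioi (0 : ℝ), Real.log u * Real.exp (-u) = -Real.eulerMascheroniConstant := by
  have h1 := Complex.hasDerivAt_GammaIntegral (s := 1) (by norm_num)
  have h2 : HasDerivAt Complex.GammaIntegral (-(Real.eulerMascheroniConstant : ℂ)) 1 := by
    refine Complex.hasDerivAt_Gamma_one.congr_of_eventuallyEq ?_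
    have : ∀ᶠ s : ℂ in 𝓝 1, 0 < s.re :=
      (Complex.continuous_re.tendsto 1).eventually (lt_mem_nhds (by norm_num))
    filter_upwards [this] with s hs
    exact (Complex.Gamma_eq_integral hs).symm
  have h3 := h1.unique h2
  have h4 : (∫ t : ℝ in Ioi 0, (t : ℂ) ^ ((1 : ℂ) - 1) * (Real.log t * Real.exp (-t)))
      = ((∫ u in Ioi (0 : ℝ), Real.log u * Real.exp (-u) : ℝ) : ℂ) := by
    rw [← integral_complex_ofReal]
    refine integral_congr_ae (.of_forall fun x => ?_)
    simp
  have h5 := h4.symm.trans h3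
  exact_mod_cast h5

theorem integrableOn_inv_one_add_pow (k : ℕ) :
    IntegrableOn (fun v : ℝ => ((1 + v) ^ (k + 2))⁻¹) (Ioi 0) ∧
      ∫ v in Ioi (0 : ℝ), ((1 + v) ^ (k + 2))⁻¹ = 1 / ((k : ℝ) + 1) := by
  have hd : ∀ x ∈ Ici (0 : ℝ), HasDerivAt (fun v : ℝ => -(1 / ((k : ℝ) + 1)) * ((1 + v) ^ (k + 1))⁻¹)
      (((1 + x) ^ (k + 2))⁻¹) x := by
    intro x hx
    have hx' : (1 + x) ≠ 0 := by have := mem_Ici.1 hx; positivity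
    have := ((((hasDerivAt_id x).const_add 1).pow (k + 1)).inv (pow_ne_zero _ hx')).const_mul
      (-(1 / ((k : ℝ) + 1)))
    refine this.congr_deriv ?_
    simp only [id, Pi.pow_apply]
    push_cast
    field_simp
    ring
  have hlim : Tendsto (fun v : ℝ => -(1 / ((k : ℝ) + 1)) * ((1 + v) ^ (k + 1))⁻¹) atTop (𝓝 0) := by
    have : Tendsto (fun v : ℝ => ((1 + v) ^ (k + 1))⁻¹) atTop (𝓝 0) :=
      ((tendsto_pow_atTop (by omega)).comp (tendsto_atTop_add_const_left _ 1 tendsto_id)).inv_tendsto_atTop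
    simpa using this.const_mul (-(1 / ((k : ℝ) + 1)))
  have hpos : ∀ x ∈ Ioi (0 : ℝ), 0 ≤ ((1 + x) ^ (k + 2))⁻¹ := fun x hx => by
    have := mem_Ioi.1 hx; positivity
  refine ⟨integrableOn_Ioi_deriv_of_nonneg' hd hpos hlim, ?_⟩
  rw [integral_Ioi_of_hasDerivAt_of_nonneg' hd hpos hlim]
  simp

/-- The mean `𝔼 (1 + t g)⁻¹` for a gain `g` that has the Gamma law with `d` degrees of freedom,
written through the Laplace transform `(1 + s)⁻ᵈ` of that law. -/
def gammaInvMean (d : ℕ) (t : ℝ) : ℝ :=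
  ∫ u in Ioi (0 : ℝ), Real.exp (-u) * ((1 + t * u) ^ d)⁻¹

/-- After the substitution `v = t u` the weight `e⁻ᵘ` becomes `exp (-v / t)` and tends to one. -/
theorem tendsto_mul_gammaInvMean_add_two (k : ℕ) :
    Tendsto (fun t => t * gammaInvMean (k + 2) t) atTop (𝓝 (1 / ((k : ℝ) + 1))) := by
  have h1 : (fun t => ∫ v in Ioi (0 : ℝ), Real.exp (-(t⁻¹ * v)) * ((1 + v) ^ (k + 2))⁻¹) =ᶠ[atTop]
      fun t => t * gammaInvMean (k + 2) t := by
    filter_upwards [eventually_gt_atTop 0] with t ht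
    have := integral_comp_mul_left_Ioi
      (fun v : ℝ => Real.exp (-(t⁻¹ * v)) * ((1 + v) ^ (k + 2))⁻¹) 0 ht
    rw [mul_zero, smul_eq_mul] at this
    rw [gammaInvMean]
    have e : ∀ u, Real.exp (-(t⁻¹ * (t * u))) = Real.exp (-u) := fun u => by
      congr 2; field_simp
    simp only [e] at this
    rw [this]; field_simp
  refine Tendsto.congr' h1 ?_
  rw [← (integrableOn_inv_one_add_pow k).2]
  refine tendsto_integral_filter_of_dominated_convergence (fun v => ((1 + v) ^ (k + 2))⁻¹) ?_ ?_
    (integrableOn_inv_one_add_pow k).1 ?_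
  · exact .of_forall fun t => Measurable.aestronglyMeasurable (by fun_prop)
  · filter_upwards [eventually_gt_atTop 0] with t ht
    refine (ae_restrict_iff' measurableSet_Ioi).2 (.of_forall fun v hv => ?_)
    have hv := mem_Ioi.1 hv
    rw [norm_of_nonneg (by positivity)]
    refine mul_le_of_le_one_left (by positivity) (Real.exp_le_one_iff.2 ?_)
    have : 0 ≤ t⁻¹ * v := by positivity
    linarith
  · refine .of_forall fun v => ?_
    have : Tendsto (fun t : ℝ => Real.exp (-(t⁻¹ * v))) atTop (𝓝 (Real.exp (-(0 * v)))) :=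
      (Real.continuous_exp.tendsto _).comp ((tendsto_inv_atTop_zero.mul_const v).neg)
    simpa using this.mul_const _

/-- Integration by parts: `t / (1 + t u)` is the derivative of `log (1 + t u)`. -/
theorem mul_gammaInvMean_one {t : ℝ} (ht : 0 < t) :
    t * gammaInvMean 1 t = ∫ u in Ioi (0 : ℝ), Real.log (1 + t * u) * Real.exp (-u) := by
  have hexp : IntegrableOn (fun u : ℝ => Real.exp (-u)) (Ioi 0) := integrableOn_exp_neg_Ioi 0
  have hA : IntegrableOn (fun u : ℝ => u * Real.exp (-u)) (Ioi 0) := by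
    have := Real.GammaIntegral_convergent (s := 2) (by norm_num)
    refine this.congr_fun (fun x _ => ?_) measurableSet_Ioi
    norm_num; ring
  have hB : IntegrableOn (fun u : ℝ => Real.log (1 + t * u) * -Real.exp (-u)) (Ioi 0) := by
    refine (hA.const_mul t).mono' (Measurable.aestronglyMeasurable (by fun_prop)) ?_
    refine (ae_restrict_iff' measurableSet_Ioi).2 (.of_forall fun v hv => ?_)
    have hv := mem_Ioi.1 hv
    have h0 : 0 ≤ t * v := by positivity
    rw [mul_neg, norm_neg, norm_of_nonneg
      (mul_nonneg (Real.log_nonneg (by linarith)) (Real.exp_pos _).le), ← mul_assoc]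
    refine mul_le_mul_of_nonneg_right ?_ (Real.exp_pos _).le
    have := Real.log_le_sub_one_of_pos (show 0 < 1 + t * v by linarith)
    linarith
  have hC : IntegrableOn (fun u : ℝ => t / (1 + t * u) * Real.exp (-u)) (Ioi 0) := by
    refine (hexp.const_mul t).mono' (Measurable.aestronglyMeasurable (by fun_prop)) ?_
    refine (ae_restrict_iff' measurableSet_Ioi).2 (.of_forall fun v hv => ?_)
    have hv := mem_Ioi.1 hv
    rw [norm_of_nonneg (by positivity)]
    refine mul_le_mul_of_nonneg_right ?_ (Real.exp_pos _).le
    refine div_le_self ht.le ?_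
    have : 0 ≤ t * v := by positivity
    linarith
  have key := integral_Ioi_mul_deriv_eq_deriv_mul (a := 0) (a' := 0) (b' := 0)
    (u := fun u : ℝ => Real.log (1 + t * u)) (v := fun u => Real.exp (-u))
    (u' := fun u => t / (1 + t * u)) (v' := fun u => -Real.exp (-u)) ?_ ?_ hB hC ?_ ?_
  · have e : t * gammaInvMean 1 t = ∫ u in Ioi (0 : ℝ), t / (1 + t * u) * Real.exp (-u) := by
      rw [gammaInvMean, ← integral_const_mul]
      refine integral_congr_ae (.of_forall fun x => ?_)
      simp only [pow_one]; ring
    rw [e]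
    simp only [mul_neg, integral_neg] at key
    linarith
  · intro x hx
    have hx := mem_Ioi.1 hx
    have := (((hasDerivAt_id x).const_mul t).const_add 1).log (by simp only [id]; positivity)
    simpa using this
  · intro x _
    simpa using (hasDerivAt_neg x).exp
  · have hc : ContinuousAt (fun u : ℝ => Real.log (1 + t * u) * Real.exp (-u)) 0 := by
      refine ContinuousAt.mul (ContinuousAt.log (by fun_prop) (by norm_num)) (by fun_prop)
    have := hc.tendsto
    simp only [mul_zero, add_zero, Real.log_one, zero_mul] at this
    exact this.mono_left inf_le_left
  · have h1 : Tendsto (fun u : ℝ => t * (u ^ 1 * Real.exp (-u))) atTop (𝓝 (t * 0)) :=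
      (Real.tendsto_pow_mul_exp_neg_atTop_nhds_zero 1).const_mul t
    rw [mul_zero] at h1
    refine squeeze_zero' ?_ ?_ h1
    · filter_upwards [eventually_gt_atTop 0] with u hu
      have h0 : 0 ≤ t * u := by positivity
      exact mul_nonneg (Real.log_nonneg (by linarith)) (Real.exp_pos _).le
    · filter_upwards [eventually_gt_atTop 0] with u hu
      have h0 : 0 ≤ t * u := by positivity
      rw [pow_one, ← mul_assoc]
      refine mul_le_mul_of_nonneg_right ?_ (Real.exp_pos _).le
      have := Real.log_le_sub_one_of_pos (show 0 < 1 + t * u by linarith)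
      linarith

/-- After integration by parts, `log (1 + t u) = log t + log (1 / t + u)`, where the second term is
dominated by an integrable function for `t ≥ 1`. -/
theorem tendsto_mul_gammaInvMean_one :
    Tendsto (fun t => t * gammaInvMean 1 t - Real.log t) atTop (𝓝 (-Real.eulerMascheroniConstant)) := by
  have hexp : IntegrableOn (fun u : ℝ => Real.exp (-u)) (Ioi 0) := integrableOn_exp_neg_Ioi 0
  have hA : IntegrableOn (fun u : ℝ => u * Real.exp (-u)) (Ioi 0) := by
    have := Real.GammaIntegral_convergent (s := 2) (by norm_num)
    refine this.congr_fun (fun x _ => ?_) measurableSet_Ioi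
    norm_num; ring
  have hlog := integrableOn_log_mul_exp_neg
  have hbound : ∀ t : ℝ, 1 ≤ t → ∀ u : ℝ, 0 < u →
      ‖Real.log (t⁻¹ + u) * Real.exp (-u)‖ ≤ ‖Real.log u * Real.exp (-u)‖ + u * Real.exp (-u) := by
    intro t ht u hu
    have ht0 : 0 < t⁻¹ := by positivity
    have ht1 : t⁻¹ ≤ 1 := inv_le_one_of_one_le₀ ht
    rw [norm_mul, norm_mul, norm_of_nonneg (Real.exp_pos (-u)).le, ← add_mul]
    refine mul_le_mul_of_nonneg_right ?_ (Real.exp_pos _).le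
    have h1 : Real.log u ≤ Real.log (t⁻¹ + u) := Real.log_le_log hu (by linarith)
    have h2 := Real.log_le_sub_one_of_pos (show 0 < t⁻¹ + u by linarith)
    rw [Real.norm_eq_abs, Real.norm_eq_abs, abs_le]
    exact ⟨by linarith [neg_abs_le (Real.log u)], by linarith [abs_nonneg (Real.log u)]⟩
  have hdom : IntegrableOn (fun u : ℝ => ‖Real.log u * Real.exp (-u)‖ + u * Real.exp (-u)) (Ioi 0) :=
    hlog.norm.add hA
  have h1 : (fun t : ℝ => ∫ u in Ioi (0 : ℝ), Real.log (t⁻¹ + u) * Real.exp (-u)) =ᶠ[atTop]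
      fun t => t * gammaInvMean 1 t - Real.log t := by
    filter_upwards [eventually_ge_atTop 1] with t ht
    have ht0 : 0 < t := by linarith
    have hi : IntegrableOn (fun u : ℝ => Real.log (t⁻¹ + u) * Real.exp (-u)) (Ioi 0) :=
      hdom.mono' (Measurable.aestronglyMeasurable (by fun_prop))
        ((ae_restrict_iff' measurableSet_Ioi).2 (.of_forall fun u hu => hbound t ht u hu))
    have e : ∫ u in Ioi (0 : ℝ), Real.log (1 + t * u) * Real.exp (-u) =
        ∫ u in Ioi (0 : ℝ), (Real.log t * Real.exp (-u) + Real.log (t⁻¹ + u) * Real.exp (-u)) := by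
      refine setIntegral_congr_fun measurableSet_Ioi fun u hu => ?_
      have hu := mem_Ioi.1 hu
      have : 1 + t * u = t * (t⁻¹ + u) := by field_simp
      simp only [this]
      rw [Real.log_mul ht0.ne' (by positivity), add_mul]
    rw [mul_gammaInvMean_one ht0, e, integral_add (hexp.const_mul _) hi, integral_const_mul,
      integral_exp_neg_Ioi_zero]
    ring
  refine Tendsto.congr' h1 ?_
  rw [← integral_log_mul_exp_neg]
  refine tendsto_integral_filter_of_dominated_convergence _ ?_ ?_ hdom ?_
  · exact .of_forall fun t => Measurable.aestronglyMeasurable (by fun_prop)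
  · filter_upwards [eventually_ge_atTop 1] with t ht
    exact (ae_restrict_iff' measurableSet_Ioi).2 (.of_forall fun u hu => hbound t ht u hu)
  · refine (ae_restrict_iff' measurableSet_Ioi).2 (.of_forall fun u hu => ?_)
    have hu := mem_Ioi.1 hu
    refine Tendsto.mul_const _ (Tendsto.log ?_ hu.ne')
    simpa using (tendsto_inv_atTop_zero (𝕜 := ℝ)).add_const u

end VBlast

/-! ### Complex Gaussian vectors -/

namespace VBlast

theorem measurable_complex_mk : Measurable (fun p : ℝ × ℝ => (⟨p.1, p.2⟩ : ℂ)) :=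
  Complex.measurableEquivRealProd.symm.measurable

instance : IsProbabilityMeasure complexGaussian :=
  Measure.isProbabilityMeasure_map measurable_complex_mk.aemeasurable

theorem integral_complexGaussian {E : Type*} [NormedAddCommGroup E] [NormedSpace ℝ E]
    (f : ℂ → E) :
    ∫ z, f z ∂complexGaussian =
      ∫ p : ℝ × ℝ, f ⟨p.1, p.2⟩ ∂(gaussianReal 0 (1 / 2)).prod (gaussianReal 0 (1 / 2)) :=
  MeasureTheory.integral_map_equiv Complex.measurableEquivRealProd.symm f

theorem integrable_norm_sq_complexGaussian : Integrable (fun z => ‖z‖ ^ 2) complexGaussian := by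
  have h : Integrable (fun x : ℝ => x ^ 2) (gaussianReal 0 (1 / 2)) :=
    (memLp_id_gaussianReal 2).integrable_sq
  have h2 := (h.comp_fst (gaussianReal 0 (1 / 2))).add (h.comp_snd (gaussianReal 0 (1 / 2)))
  refine (integrable_map_equiv Complex.measurableEquivRealProd.symm _).2 (h2.congr (.of_forall fun p => ?_))
  simp only [Pi.add_apply]
  rw [Function.comp_apply, ← Complex.normSq_eq_norm_sq, Complex.normSq_apply, ← sq, ← sq]
  rfl

theorem integral_cexp_re_complexGaussian (t : ℂ) :
    ∫ z, Complex.exp ((z * t).re * Complex.I) ∂complexGaussian =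
      ((Real.exp (-‖t‖ ^ 2 / 4) : ℝ) : ℂ) := by
  have hc : ∀ s : ℝ, ∫ x : ℝ, Complex.exp (s * x * Complex.I) ∂gaussianReal 0 (1 / 2) =
      Complex.exp (-(s ^ 2 / 4 : ℂ)) := fun s => by
    rw [← charFun_apply_real, charFun_gaussianReal]
    congr 1
    simp
    ring
  rw [integral_complexGaussian]
  have e : ∀ p : ℝ × ℝ, Complex.exp ((((⟨p.1, p.2⟩ : ℂ) * t).re : ℂ) * Complex.I) =
      Complex.exp ((t.re : ℝ) * p.1 * Complex.I) * Complex.exp (((-t.im : ℝ) : ℂ) * p.2 * Complex.I) := by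
    intro p
    rw [← Complex.exp_add]
    congr 1
    simp only [Complex.mul_re]
    push_cast
    ring
  simp only [e]
  rw [integral_prod_mul (fun x : ℝ => Complex.exp ((t.re : ℝ) * x * Complex.I))
    (fun x : ℝ => Complex.exp (((-t.im : ℝ) : ℂ) * x * Complex.I)), hc, hc, ← Complex.exp_add,
    ← Complex.normSq_eq_norm_sq, Complex.normSq_apply, Complex.ofReal_exp]
  congr 1
  push_cast
  ring

theorem integral_exp_neg_mul_sq_gaussianReal {s : ℝ} (hs : 0 ≤ s) :
    ∫ x : ℝ, Real.exp (-(s * x ^ 2)) ∂gaussianReal 0 (1 / 2) = (√(1 + s))⁻¹ := by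
  rw [integral_gaussianReal_eq_integral_smul (by norm_num)]
  have e : ∀ x : ℝ, gaussianPDFReal 0 (1 / 2) x • Real.exp (-(s * x ^ 2)) =
      (√π)⁻¹ * Real.exp (-(1 + s) * x ^ 2) := by
    intro x
    rw [gaussianPDFReal, smul_eq_mul, mul_assoc, ← Real.exp_add]
    congr 1
    · congr 2
      push_cast
      ring
    · congr 1
      push_cast
      ring
  simp only [e]
  rw [integral_const_mul, integral_gaussian, Real.sqrt_div Real.pi_pos.le]
  have := Real.sqrt_pos.2 Real.pi_pos
  field_simp

theorem integral_exp_neg_norm_sq_complexGaussian {s : ℝ} (hs : 0 ≤ s) :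
    ∫ z, Real.exp (-(s * ‖z‖ ^ 2)) ∂complexGaussian = (1 + s)⁻¹ := by
  rw [integral_complexGaussian]
  have e : ∀ p : ℝ × ℝ, Real.exp (-(s * ‖(⟨p.1, p.2⟩ : ℂ)‖ ^ 2)) =
      Real.exp (-(s * p.1 ^ 2)) * Real.exp (-(s * p.2 ^ 2)) := by
    intro p
    rw [← Real.exp_add, ← Complex.normSq_eq_norm_sq, Complex.normSq_apply]
    congr 1
    ring
  simp only [e]
  rw [integral_prod_mul (fun x : ℝ => Real.exp (-(s * x ^ 2)))
    (fun x : ℝ => Real.exp (-(s * x ^ 2))), integral_exp_neg_mul_sq_gaussianReal hs, ← mul_inv,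
    Real.mul_self_sqrt (by linarith)]

/-- The law of a vector of i.i.d. complex Gaussian entries. -/
def gaussianVector (ι : Type*) [Fintype ι] : Measure (ι → ℂ) :=
  Measure.pi fun _ => complexGaussian

instance (ι : Type*) [Fintype ι] : IsProbabilityMeasure (gaussianVector ι) := by
  unfold gaussianVector; infer_instance

theorem integral_cexp_re_gaussianVector {ι : Type*} [Fintype ι] (t : ι → ℂ) :
    ∫ z, Complex.exp ((∑ k, z k * t k).re * Complex.I) ∂gaussianVector ι =
      ((Real.exp (-(∑ k, ‖t k‖ ^ 2) / 4) : ℝ) : ℂ) := by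
  have e : ∀ z : ι → ℂ, Complex.exp ((∑ k, z k * t k).re * Complex.I) =
      ∏ k, Complex.exp ((z k * t k).re * Complex.I) := by
    intro z
    rw [← Complex.exp_sum, Complex.re_sum, Complex.ofReal_sum, Finset.sum_mul]
  simp only [e]
  rw [gaussianVector, integral_fintype_prod_eq_prod
    (fun k (z : ℂ) => Complex.exp ((z * t k).re * Complex.I))]
  simp only [integral_cexp_re_complexGaussian]
  rw [← Complex.ofReal_prod, ← Real.exp_sum, ← Finset.sum_div, Finset.sum_neg_distrib]

theorem integral_exp_neg_norm_sq_gaussianVector {ι : Type*} [Fintype ι] {s : ℝ} (hs : 0 ≤ s) :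
    ∫ z, Real.exp (-(s * ∑ k, ‖z k‖ ^ 2)) ∂gaussianVector ι = ((1 + s) ^ Fintype.card ι)⁻¹ := by
  have e : ∀ z : ι → ℂ, Real.exp (-(s * ∑ k, ‖z k‖ ^ 2)) = ∏ k, Real.exp (-(s * ‖z k‖ ^ 2)) := by
    intro z
    rw [← Real.exp_sum, Finset.mul_sum, Finset.sum_neg_distrib]
  simp only [e]
  rw [gaussianVector, integral_fintype_prod_eq_prod (fun _ (z : ℂ) => Real.exp (-(s * ‖z‖ ^ 2)))]
  simp [integral_exp_neg_norm_sq_complexGaussian hs]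

open scoped InnerProductSpace in
/-- The squared length of the projection of an i.i.d. complex Gaussian vector to a fixed subspace
of dimension `d` has the Laplace transform `(1 + s)⁻ᵈ`.  The proof writes `exp (-s ‖p‖²)` as the
characteristic function of a second, independent Gaussian vector `w` of coefficients with respect
to an orthonormal basis of the subspace, and exchanges the two expectations; this replaces the
unitary invariance of the Gaussian law. -/
theorem integral_exp_neg_norm_sq_starProjection {n : ℕ}
    (W : Submodule ℂ (EuclideanSpace ℂ (Fin n))) {s : ℝ} (hs : 0 ≤ s) :
    ∫ z, Real.exp (-(s * ‖W.starProjection (WithLp.toLp 2 z)‖ ^ 2)) ∂gaussianVector (Fin n) =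
      ((1 + s) ^ Module.finrank ℂ W)⁻¹ := by
  set d := Module.finrank ℂ W with hd
  let b : OrthonormalBasis (Fin d) ℂ W := stdOrthonormalBasis ℂ W
  -- with this scale the characteristic function `exp (-c² ‖p‖² / 4)` is `exp (-s ‖p‖²)`
  set c : ℝ := 2 * √s with hc
  have hc2 : c ^ 2 / 4 = s := by rw [hc, mul_pow, Real.sq_sqrt hs]; ring
  have hproj : ∀ x, ‖W.starProjection x‖ ^ 2 = ∑ k, ‖⟪(b k : EuclideanSpace ℂ (Fin n)), x⟫_ℂ‖ ^ 2 := by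
    intro x
    have h1 := b.sum_sq_norm_inner_right (W.orthogonalProjectionOnto x)
    rw [← Submodule.coe_orthogonalProjectionOnto_apply, ← Submodule.coe_norm, ← h1]
    exact Finset.sum_congr rfl fun k _ => by
      rw [Submodule.inner_orthogonalProjectionOnto_eq_of_mem_left]
  -- the bilinear form that couples the two Gaussian vectors
  let B : (Fin n → ℂ) → (Fin d → ℂ) → ℂ := fun z w =>
    ∑ a, z a * (c * ∑ k, w k * (starRingEnd ℂ) ((b k : EuclideanSpace ℂ (Fin n)) a))
  have hB : ∀ z w, B z w = ∑ k, w k * (c * ⟪(b k : EuclideanSpace ℂ (Fin n)), WithLp.toLp 2 z⟫_ℂ) := by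
    intro z w
    simp only [B, Finset.mul_sum, PiLp.inner_apply, RCLike.inner_apply]
    rw [Finset.sum_comm]
    exact Finset.sum_congr rfl fun k _ => Finset.sum_congr rfl fun a _ => by ring
  have hw : ∀ w : Fin d → ℂ, ∑ a, ‖(c : ℂ) * ∑ k, w k *
      (starRingEnd ℂ) ((b k : EuclideanSpace ℂ (Fin n)) a)‖ ^ 2 = c ^ 2 * ∑ k, ‖w k‖ ^ 2 := by
    intro w
    have h1 : ‖∑ k, (starRingEnd ℂ) (w k) • (b k)‖ ^ 2 = ∑ k, ‖w k‖ ^ 2 := by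
      have := b.sum_sq_norm_inner_right (∑ k, (starRingEnd ℂ) (w k) • (b k))
      rw [← this]
      refine Finset.sum_congr rfl fun k _ => ?_
      rw [b.orthonormal.inner_right_fintype]
      simp
    rw [← h1, Submodule.coe_norm, EuclideanSpace.norm_sq_eq, Finset.mul_sum]
    refine Finset.sum_congr rfl fun a _ => ?_
    rw [norm_mul, mul_pow]
    congr 1
    · simp
    · rw [← RCLike.norm_conj]
      simp
  have hL : ∀ z, ((Real.exp (-(s * ‖W.starProjection (WithLp.toLp 2 z)‖ ^ 2)) : ℝ) : ℂ) =
      ∫ w, Complex.exp ((B z w).re * Complex.I) ∂gaussianVector (Fin d) := by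
    intro z
    simp only [hB]
    rw [integral_cexp_re_gaussianVector, hproj, ← hc2]
    congr 2
    simp only [norm_mul, mul_pow, Complex.norm_real, Real.norm_eq_abs, sq_abs]
    rw [← Finset.mul_sum]
    ring
  have hR : ∀ w, ∫ z, Complex.exp ((B z w).re * Complex.I) ∂gaussianVector (Fin n) =
      ((Real.exp (-(s * ∑ k, ‖w k‖ ^ 2)) : ℝ) : ℂ) := by
    intro w
    simp only [B]
    rw [integral_cexp_re_gaussianVector, hw, ← hc2]
    congr 2
    ring
  have hint : Integrable (Function.uncurry fun z w => Complex.exp ((B z w).re * Complex.I))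
      ((gaussianVector (Fin n)).prod (gaussianVector (Fin d))) := by
    refine Integrable.of_bound (C := 1) ?_ (.of_forall fun p => ?_)
    · refine Continuous.aestronglyMeasurable ?_
      simp only [Function.uncurry_def, B]
      fun_prop
    · rw [Function.uncurry_def, Complex.norm_exp_ofReal_mul_I]
  have key := integral_integral_swap hint
  simp only [← hL, hR, integral_complex_ofReal] at key
  rw [Complex.ofReal_inj.1 key, integral_exp_neg_norm_sq_gaussianVector hs, Fintype.card_fin]

end VBlast

/-! ### The law of the gains -/

namespace VBlast

/-- The distance to a span of measurable vectors is the infimum of the distances to the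
combinations with coefficients in a countable dense set, which makes it measurable. -/
theorem measurable_norm_starProjection_span {β : Type*} [MeasurableSpace β] {n : ℕ} {ι : Type*}
    [Fintype ι] {v : ι → β → EuclideanSpace ℂ (Fin n)} {h : β → EuclideanSpace ℂ (Fin n)}
    (hv : ∀ j, Measurable (v j)) (hh : Measurable h) :
    Measurable fun x => ‖(Submodule.span ℂ (range fun j => v j x))ᗮ.starProjection (h x)‖ := by
  let e : ℕ → ι → ℂ := TopologicalSpace.denseSeq (ι → ℂ)
  have he : DenseRange e := TopologicalSpace.denseRange_denseSeq (ι → ℂ)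
  refine Measurable.isGLB (ι := ℕ) (f := fun k x => ‖h x - ∑ j, e k j • v j x‖) ?_ ?_
  · intro k
    exact (hh.sub (Finset.measurable_fun_sum _ fun j _ => (hv j).const_smul (e k j))).norm
  · intro x
    set U := Submodule.span ℂ (range fun j => v j x) with hU
    constructor
    · rintro _ ⟨k, rfl⟩
      have hmem : ∑ j, e k j • v j x ∈ U :=
        (Submodule.mem_span_range_iff_exists_fun ℂ).2 ⟨e k, rfl⟩
      have h0 := Submodule.starProjection_orthogonal_apply_eq_zero hmem
      have h1 := Submodule.norm_starProjection_apply_le Uᗮ (h x - ∑ j, e k j • v j x)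
      rwa [map_sub, h0, sub_zero] at h1
    · intro b hb
      obtain ⟨c, hc⟩ := (Submodule.mem_span_range_iff_exists_fun ℂ).1
        (Submodule.starProjection_apply_mem U (h x))
      rw [Submodule.starProjection_orthogonal_val, ← hc]
      refine he.induction_on (p := fun c : ι → ℂ => b ≤ ‖h x - ∑ j, c j • v j x‖) c
        (isClosed_le continuous_const (by fun_prop)) fun k => hb ⟨k, rfl⟩

variable {n m : ℕ}

open Classical in
theorem interference_eq_span_range (H : Matrix (Fin n) (Fin m) ℂ) (S : Set (Fin m)) (i : Fin m) :
    interference H S i =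
      Submodule.span ℂ (range fun j => if i < j ∧ j ∈ S then column H j else 0) := by
  rw [interference]
  apply le_antisymm
  · refine Submodule.span_mono ?_
    rintro _ ⟨j, hj, rfl⟩
    exact ⟨j, if_pos hj⟩
  · rw [Submodule.span_le]
    rintro _ ⟨j, rfl⟩
    dsimp only
    split_ifs with hj
    · exact Submodule.subset_span ⟨j, hj, rfl⟩
    · exact Submodule.zero_mem _

/-- The channel matrix with given entries, which are indexed by pairs so that they form a
measurable space. -/
def ofEntries (x : Fin n × Fin m → ℂ) : Matrix (Fin n) (Fin m) ℂ := fun a j => x (a, j)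

theorem ofEntries_entries (H : Matrix (Fin n) (Fin m) ℂ) :
    ofEntries (fun p : Fin n × Fin m => H p.1 p.2) = H := rfl

theorem measurable_norm_starProjection_interference (S : Set (Fin m)) (i : Fin m) :
    Measurable fun p : (Fin n → ℂ) × (Fin n × Fin m → ℂ) =>
      ‖(interference (ofEntries p.2) S i)ᗮ.starProjection (WithLp.toLp 2 p.1)‖ := by
  classical
  simp only [interference_eq_span_range]
  refine measurable_norm_starProjection_span
    (v := fun j (p : (Fin n → ℂ) × (Fin n × Fin m → ℂ)) =>
      if i < j ∧ j ∈ S then column (ofEntries p.2) j else 0) ?_ ?_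
  · intro j
    by_cases hj : i < j ∧ j ∈ S
    · simp only [hj]
      refine (WithLp.measurable_toLp 2 _).comp (measurable_pi_lambda _ fun a => ?_)
      exact (measurable_pi_apply (a, j)).comp measurable_snd
    · simp only [hj, if_false]
      exact measurable_const
  · exact (WithLp.measurable_toLp 2 _).comp measurable_fst

theorem measurable_gain (S : Set (Fin m)) (i : Fin m) :
    Measurable fun x : Fin n × Fin m → ℂ => gain (ofEntries x) S i := by
  have h : Measurable fun x : Fin n × Fin m → ℂ => ((fun a => x (a, i)), x) := by
    fun_prop
  exact ((measurable_norm_starProjection_interference S i).comp h).pow_const 2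

theorem gain_nonneg (H : Matrix (Fin n) (Fin m) ℂ) (S : Set (Fin m)) (i : Fin m) :
    0 ≤ gain H S i := sq_nonneg _

theorem gain_le (H : Matrix (Fin n) (Fin m) ℂ) (S : Set (Fin m)) (i : Fin m) :
    gain H S i ≤ ∑ a, ‖H a i‖ ^ 2 := by
  have h := Submodule.norm_starProjection_apply_le (interference H S i)ᗮ (column H i)
  calc gain H S i ≤ ‖column H i‖ ^ 2 := pow_le_pow_left₀ (norm_nonneg _) h 2
    _ = _ := by rw [EuclideanSpace.norm_sq_eq]; rfl

/-- A vanishing combination of the columns, projected to the complement of the columns `j > i`, leaves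
only the multiple of column `i`, once the coefficients before `i` are known to vanish. -/
theorem linearIndependent_column (H : Matrix (Fin n) (Fin m) ℂ) (h : ∀ i, 0 < gain H univ i) :
    LinearIndependent ℂ (column H) := by
  rw [Fintype.linearIndependent_iff]
  intro c hc i
  induction i using WellFoundedLT.induction with
  | ind i ih =>
  have h1 : ∀ j, i < j → (interference H univ i)ᗮ.starProjection (column H j) = 0 := fun j hj =>
    Submodule.starProjection_orthogonal_apply_eq_zero (Submodule.subset_span ⟨j, ⟨hj, mem_univ _⟩, rfl⟩)
  have h2 := congrArg (interference H univ i)ᗮ.starProjection hc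
  rw [map_sum, map_zero, Finset.sum_eq_single i] at h2
  · rw [map_smul, smul_eq_zero] at h2
    refine h2.resolve_right fun h0 => ?_
    have := h i
    rw [gain, h0] at this
    simp at this
  · intro j _ hj
    rw [map_smul]
    rcases lt_or_gt_of_ne hj with hj | hj
    · rw [ih j hj, zero_smul]
    · rw [h1 j hj, smul_zero]
  · simp

theorem finrank_interference_le (H : Matrix (Fin n) (Fin m) ℂ) (i : Fin m) :
    Module.finrank ℂ (interference H univ i) ≤ m - 1 - i := by
  have e : interference H univ i =
      Submodule.span ℂ (range fun j : Finset.Ioi i => column H j) := by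
    rw [interference]; congr 1; ext x; simp
  rw [e, ← Fin.card_Ioi, ← Fintype.card_coe]
  exact finrank_range_le_card _

theorem finrank_interference (H : Matrix (Fin n) (Fin m) ℂ) (h : ∀ i, 0 < gain H univ i)
    (i : Fin m) : Module.finrank ℂ (interference H univ i) = m - 1 - i := by
  have e : interference H univ i =
      Submodule.span ℂ (range fun j : Finset.Ioi i => column H j) := by
    rw [interference]; congr 1; ext x; simp
  rw [e, ← Fin.card_Ioi, ← Fintype.card_coe]
  exact finrank_span_eq_card ((linearIndependent_column H h).comp _ Subtype.val_injective)

section Random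

variable {Ω : Type*} [MeasurableSpace Ω] {P : Measure Ω} {H : Ω → Matrix (Fin n) (Fin m) ℂ}

theorem IsIIDRayleigh.aemeasurable_entries (hH : IsIIDRayleigh P H) :
    AEMeasurable (fun ω (p : Fin n × Fin m) => H ω p.1 p.2) P :=
  aemeasurable_pi_lambda _ fun p => (hH.law p.1 p.2).aemeasurable

theorem IsIIDRayleigh.aemeasurable_gain (hH : IsIIDRayleigh P H) (S : Set (Fin m)) (i : Fin m) :
    AEMeasurable (fun ω => gain (H ω) S i) P := by
  have h := (measurable_gain S i).comp_aemeasurable hH.aemeasurable_entries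
  simpa only [Function.comp_def, ofEntries_entries] using h

theorem IsIIDRayleigh.integrable_gain (hH : IsIIDRayleigh P H) (S : Set (Fin m)) (i : Fin m) :
    Integrable (fun ω => gain (H ω) S i) P := by
  have h : Integrable (fun ω => ∑ a, ‖H ω a i‖ ^ 2) P := by
    refine integrable_finsetSum _ fun a _ => ?_
    have h1 := hH.law a i
    have h2 := integrable_norm_sq_complexGaussian
    rw [← h1.map_eq] at h2
    exact h2.comp_aemeasurable h1.aemeasurable
  refine h.mono' (hH.aemeasurable_gain S i).aestronglyMeasurable (.of_forall fun ω => ?_)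
  rw [norm_of_nonneg (gain_nonneg _ _ _)]
  exact gain_le _ _ _

/-- Conditionally on the other columns, stream `i` sees a Gaussian vector that is independent of
the interference. -/
theorem IsIIDRayleigh.integral_exp_neg_gain_eq [IsProbabilityMeasure P] (hH : IsIIDRayleigh P H)
    (i : Fin m) {s : ℝ} (hs : 0 ≤ s) :
    ∫ ω, Real.exp (-(s * gain (H ω) univ i)) ∂P =
      ∫ ω, ((1 + s) ^ (n - Module.finrank ℂ (interference (H ω) univ i)))⁻¹ ∂P := by
  classical
  let z : Ω → Fin n → ℂ := fun ω a => H ω a i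
  -- column `i` is replaced by zero, which makes the rest of the channel independent of it
  let X : Ω → Fin n × Fin m → ℂ := fun ω p => if p.2 = i then 0 else H ω p.1 p.2
  have hzm : AEMeasurable z P := aemeasurable_pi_lambda _ fun a => (hH.law a i).aemeasurable
  have hXm : AEMeasurable X P := by
    refine aemeasurable_pi_lambda _ fun p => ?_
    by_cases hp : p.2 = i
    · simp only [X, hp, if_true]; exact aemeasurable_const
    · simp only [X, hp, if_false]; exact (hH.law p.1 p.2).aemeasurable
  have hXint : ∀ ω, interference (ofEntries (X ω)) univ i = interference (H ω) univ i := by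
    intro ω
    rw [interference, interference]
    congr 1
    refine image_congr fun j hj => ?_
    ext a
    have : j ≠ i := hj.1.ne'
    simp [column, ofEntries, X, this]
  have hzlaw : P.map z = gaussianVector (Fin n) := by
    have h1 : iIndepFun (fun a ω => H ω a i) P :=
      hH.indep.precomp (g := fun a : Fin n => (a, i)) (fun a b h => by simpa using h)
    rw [gaussianVector, show z = fun ω a => H ω a i from rfl,
      h1.map_fun_eq_pi_map fun a => (hH.law a i).aemeasurable]
    simp only [fun a => (hH.law a i).map_eq]
  have hind : IndepFun z X P := by
    let S : Finset (Fin n × Fin m) := {p | p.2 = i}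
    let T : Finset (Fin n × Fin m) := {p | p.2 ≠ i}
    have hST : Disjoint S T := Finset.disjoint_filter_filter_not _ _ _
    have h1 := hH.indep.indepFun_finset₀ S T hST fun p => (hH.law p.1 p.2).aemeasurable
    let φ : (S → ℂ) → (Fin n → ℂ) := fun x a => x ⟨(a, i), by simp [S]⟩
    let ψ : (T → ℂ) → (Fin n × Fin m → ℂ) := fun y p => if hp : p ∈ T then y ⟨p, hp⟩ else 0
    have hφ : Measurable φ := by fun_prop
    have hψ : Measurable ψ := by
      refine measurable_pi_lambda _ fun p => ?_
      by_cases hp : p ∈ T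
      · simp only [ψ, hp, dif_pos]; fun_prop
      · simp only [ψ, hp]; exact measurable_const
    have h2 := h1.comp hφ hψ
    have hzφ : z = φ ∘ fun ω (p : S) => H ω p.1.1 p.1.2 := rfl
    have hXψ : X = ψ ∘ fun ω (p : T) => H ω p.1.1 p.1.2 := by
      ext ω p
      by_cases hp : p.2 = i <;> simp [X, ψ, T, hp]
    rw [hzφ, hXψ]
    exact h2
  have hmap := hind.map_prod_eq_prod_map_map hzm hXm
  rw [hzlaw] at hmap
  have : IsProbabilityMeasure (P.map X) := Measure.isProbabilityMeasure_map hXm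
  let F : (Fin n → ℂ) × (Fin n × Fin m → ℂ) → ℝ := fun p =>
    Real.exp (-(s * ‖(interference (ofEntries p.2) univ i)ᗮ.starProjection (WithLp.toLp 2 p.1)‖ ^ 2))
  have hF : Measurable F :=
    (((measurable_norm_starProjection_interference univ i).pow_const 2).const_mul s).neg.exp
  have hFint : Integrable F ((gaussianVector (Fin n)).prod (P.map X)) := by
    refine Integrable.of_bound (C := 1) hF.aestronglyMeasurable (.of_forall fun p => ?_)
    rw [norm_of_nonneg (Real.exp_pos _).le, Real.exp_le_one_iff]
    have : 0 ≤ s * ‖(interference (ofEntries p.2) univ i)ᗮ.starProjection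
      (WithLp.toLp 2 p.1)‖ ^ 2 := by positivity
    linarith
  have hinner : ∀ x : Fin n × Fin m → ℂ, ∫ y, F (y, x) ∂gaussianVector (Fin n) =
      ((1 + s) ^ (n - Module.finrank ℂ (interference (ofEntries x) univ i)))⁻¹ := by
    intro x
    have h1 := Submodule.finrank_add_finrank_orthogonal (interference (ofEntries x) univ i)
    rw [finrank_euclideanSpace_fin] at h1
    simp only [F]
    rw [integral_exp_neg_norm_sq_starProjection _ hs]
    congr 2
    omega
  have hsm : StronglyMeasurable fun x : Fin n × Fin m → ℂ =>
      ((1 + s) ^ (n - Module.finrank ℂ (interference (ofEntries x) univ i)))⁻¹ := by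
    have := hF.stronglyMeasurable.integral_prod_left' (μ := gaussianVector (Fin n))
    simpa only [hinner] using this
  calc ∫ ω, Real.exp (-(s * gain (H ω) univ i)) ∂P = ∫ ω, F (z ω, X ω) ∂P := by
        refine integral_congr_ae (.of_forall fun ω => ?_)
        simp only [F, hXint]
        rfl
    _ = ∫ p, F p ∂(P.map fun ω => (z ω, X ω)) :=
        (integral_map (hzm.prodMk hXm) hF.aestronglyMeasurable).symm
    _ = ∫ x, ((1 + s) ^ (n - Module.finrank ℂ (interference (ofEntries x) univ i)))⁻¹ ∂(P.map X) := by
        rw [hmap, integral_prod_symm _ hFint]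
        simp only [hinner]
    _ = _ := by
        rw [integral_map hXm hsm.aestronglyMeasurable]
        exact integral_congr_ae (.of_forall fun ω => by dsimp only; rw [hXint ω])

/-- The gain has at least one degree of freedom, so its Laplace transform, which bounds the
probability that it vanishes, tends to zero. -/
theorem IsIIDRayleigh.ae_gain_pos [IsProbabilityMeasure P] (hH : IsIIDRayleigh P H) (hnm : m ≤ n)
    (i : Fin m) : ∀ᵐ ω ∂P, 0 < gain (H ω) univ i := by
  have hg := hH.aemeasurable_gain univ i
  set A : Set Ω := {ω | gain (H ω) univ i ≤ 0} with hA
  have hAm : NullMeasurableSet A P := nullMeasurableSet_le hg aemeasurable_const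
  have hle : ∀ s : ℝ, 0 ≤ s → P.real A ≤ (1 + s)⁻¹ := by
    intro s hs
    have hint : Integrable (fun ω => Real.exp (-(s * gain (H ω) univ i))) P := by
      refine Integrable.of_bound (C := 1)
        (hg.const_mul s).neg.exp.aestronglyMeasurable (.of_forall fun ω => ?_)
      rw [norm_of_nonneg (Real.exp_pos _).le, Real.exp_le_one_iff]
      have := mul_nonneg hs (gain_nonneg (H ω) univ i)
      linarith
    calc P.real A = ∫ ω, A.indicator 1 ω ∂P := by
          rw [integral_indicator₀ hAm]
          simp
      _ ≤ ∫ ω, Real.exp (-(s * gain (H ω) univ i)) ∂P := by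
          refine integral_mono_of_nonneg (.of_forall fun ω => ?_) hint (.of_forall fun ω => ?_)
          · exact indicator_nonneg (fun _ _ => zero_le_one) _
          · by_cases hω : ω ∈ A
            · have h0 : gain (H ω) univ i = 0 := le_antisymm hω (gain_nonneg _ _ _)
              simp [hω, h0]
            · simp only [hω, not_false_eq_true, indicator_of_notMem]
              positivity
      _ = ∫ ω, ((1 + s) ^ (n - Module.finrank ℂ (interference (H ω) univ i)))⁻¹ ∂P :=
          hH.integral_exp_neg_gain_eq i hs
      _ ≤ ∫ ω, (1 + s)⁻¹ ∂P := by
          refine integral_mono_of_nonneg (.of_forall fun ω => by positivity)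
            (integrable_const _) (.of_forall fun ω => ?_)
          have h1 := finrank_interference_le (H ω) i
          have h2 := i.2
          refine inv_anti₀ (by positivity) ?_
          exact le_self_pow₀ (by linarith) (by omega)
      _ = _ := by simp
  have hlim : Tendsto (fun s : ℝ => (1 + s)⁻¹) atTop (𝓝 0) :=
    (tendsto_atTop_add_const_left _ 1 tendsto_id).inv_tendsto_atTop
  have h0 : P.real A ≤ 0 :=
    ge_of_tendsto hlim ((eventually_ge_atTop 0).mono hle)
  have h1 : P A = 0 := (measureReal_eq_zero_iff).1 (le_antisymm h0 measureReal_nonneg)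
  rw [ae_iff]
  simpa [not_lt] using h1

/-- The gain of stream `i` has the Laplace transform of the Gamma law with `n - m + i + 1` degrees
of freedom (`i` counted from `0`). -/
theorem IsIIDRayleigh.integral_exp_neg_gain [IsProbabilityMeasure P] (hH : IsIIDRayleigh P H)
    (hnm : m ≤ n) (i : Fin m) {s : ℝ} (hs : 0 ≤ s) :
    ∫ ω, Real.exp (-(s * gain (H ω) univ i)) ∂P = ((1 + s) ^ (n - m + i + 1))⁻¹ := by
  rw [hH.integral_exp_neg_gain_eq i hs]
  have h : ∀ᵐ ω ∂P, ∀ i, 0 < gain (H ω) univ i := ae_all_iff.2 fun i => hH.ae_gain_pos hnm i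
  have h2 : (fun ω => ((1 + s) ^ (n - Module.finrank ℂ (interference (H ω) univ i)))⁻¹) =ᵐ[P]
      fun _ => ((1 + s) ^ (n - m + i + 1))⁻¹ := by
    filter_upwards [h] with ω hω
    rw [finrank_interference _ hω]
    have := i.2
    congr 2
    omega
  rw [integral_congr_ae h2]
  simp

/-- Fubini, applied to `(1 + t g)⁻¹ = ∫₀^∞ e⁻ᵘ exp (-t u g) du`. -/
theorem IsIIDRayleigh.integral_inv_one_add_mul_gain [IsProbabilityMeasure P]
    (hH : IsIIDRayleigh P H) (hnm : m ≤ n) (i : Fin m) {t : ℝ} (ht : 0 ≤ t) :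
    ∫ ω, (1 + t * gain (H ω) univ i)⁻¹ ∂P = gammaInvMean (n - m + i + 1) t := by
  have hg := hH.aemeasurable_gain univ i
  have hint : Integrable (Function.uncurry fun (ω : Ω) (u : ℝ) =>
      Real.exp (-u) * Real.exp (-(t * u * gain (H ω) univ i))) (P.prod (volume.restrict (Ioi 0))) := by
    have h1 : Integrable (fun p : Ω × ℝ => Real.exp (-p.2)) (P.prod (volume.restrict (Ioi 0))) :=
      Integrable.comp_snd (integrableOn_exp_neg_Ioi 0) P
    refine h1.mono ?_ ?_
    · refine AEMeasurable.aestronglyMeasurable ?_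
      have h2 : AEMeasurable (fun p : Ω × ℝ => gain (H p.1) univ i)
          (P.prod (volume.restrict (Ioi 0))) := hg.comp_fst
      have h3 : AEMeasurable (fun p : Ω × ℝ => p.2) (P.prod (volume.restrict (Ioi 0))) :=
        measurable_snd.aemeasurable
      exact h3.neg.exp.mul ((h3.const_mul t).mul h2).neg.exp
    · have h4 : ∀ᵐ p : Ω × ℝ ∂(P.prod (volume.restrict (Ioi 0))), 0 < p.2 :=
        Measure.quasiMeasurePreserving_snd.ae (ae_restrict_mem measurableSet_Ioi)
      filter_upwards [h4] with p hp
      rw [Function.uncurry_def, norm_mul]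
      refine mul_le_of_le_one_right (norm_nonneg _) ?_
      rw [norm_of_nonneg (Real.exp_pos _).le, Real.exp_le_one_iff]
      have := mul_nonneg (mul_nonneg ht hp.le) (gain_nonneg (H p.1) univ i)
      linarith
  have key := integral_integral_swap hint
  have hL : ∀ ω, ∫ u in Ioi (0 : ℝ), Real.exp (-u) * Real.exp (-(t * u * gain (H ω) univ i)) =
      (1 + t * gain (H ω) univ i)⁻¹ := by
    intro ω
    have hpos : 0 < 1 + t * gain (H ω) univ i := by
      have := mul_nonneg ht (gain_nonneg (H ω) univ i)
      linarith
    have := integral_exp_mul_Ioi (a := -(1 + t * gain (H ω) univ i)) (by linarith) 0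
    rw [mul_zero, Real.exp_zero, neg_div_neg_eq, one_div] at this
    rw [← this]
    refine integral_congr_ae (.of_forall fun u => ?_)
    simp only [← Real.exp_add]
    congr 1
    ring
  simp only [hL] at key
  rw [key, gammaInvMean]
  refine setIntegral_congr_fun measurableSet_Ioi fun u hu => ?_
  have hu := mem_Ioi.1 hu
  rw [integral_const_mul, hH.integral_exp_neg_gain hnm i (mul_nonneg ht hu.le)]

end Random

end VBlast

/-! ### The mean capacity of a single stream -/

namespace VBlast

variable {Ω : Type*} [MeasurableSpace Ω] {P : Measure Ω} {x : Ω → ℝ} {γ a b : ℝ}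

/-- The mean capacity of a stream with random gain `x` and power `a` at SNR `γ`. -/
def meanLog (P : Measure Ω) (x : Ω → ℝ) (γ a : ℝ) : ℝ :=
  ∫ ω, Real.log (1 + a * x ω * γ) ∂P

/-- The marginal mean capacity, that is, the derivative of `meanLog` with respect to the power. -/
def marginal (P : Measure Ω) (x : Ω → ℝ) (γ a : ℝ) : ℝ :=
  ∫ ω, x ω * γ / (1 + a * x ω * γ) ∂P

/-- The mean `𝔼 (1 + t x)⁻¹` of the inverse of one plus the scaled gain. -/
def invMean (P : Measure Ω) (x : Ω → ℝ) (t : ℝ) : ℝ :=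
  ∫ ω, (1 + t * x ω)⁻¹ ∂P

theorem integrable_log_one_add (hx : Integrable x P) (hx0 : ∀ᵐ ω ∂P, 0 ≤ x ω) (hγ : 0 ≤ γ)
    (ha : 0 ≤ a) : Integrable (fun ω => Real.log (1 + a * x ω * γ)) P := by
  refine ((hx.const_mul a).mul_const γ).mono'
    ((((hx.aemeasurable.const_mul a).mul_const γ).const_add 1).log).aestronglyMeasurable ?_
  filter_upwards [hx0] with ω h
  have h1 : 0 ≤ a * x ω * γ := by positivity
  rw [norm_of_nonneg (Real.log_nonneg (by linarith))]
  have := Real.log_le_sub_one_of_pos (show 0 < 1 + a * x ω * γ by linarith)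
  linarith

theorem integrable_marginal (hx : Integrable x P) (hx0 : ∀ᵐ ω ∂P, 0 ≤ x ω) (hγ : 0 ≤ γ)
    (ha : 0 ≤ a) : Integrable (fun ω => x ω * γ / (1 + a * x ω * γ)) P := by
  refine (hx.mul_const γ).mono' ((hx.aemeasurable.mul_const γ).div
    (((hx.aemeasurable.const_mul a).mul_const γ).const_add 1)).aestronglyMeasurable ?_
  filter_upwards [hx0] with ω h
  have h1 : 0 ≤ a * x ω * γ := by positivity
  rw [norm_of_nonneg (by positivity)]
  exact div_le_self (by positivity) (by linarith)

theorem integrable_inv_one_add [IsFiniteMeasure P] (hx : AEMeasurable x P)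
    (hx0 : ∀ᵐ ω ∂P, 0 ≤ x ω) {t : ℝ} (ht : 0 ≤ t) :
    Integrable (fun ω => (1 + t * x ω)⁻¹) P := by
  refine Integrable.of_bound (C := 1) ((hx.const_mul t).const_add 1).inv.aestronglyMeasurable ?_
  filter_upwards [hx0] with ω h
  have h1 : 0 ≤ t * x ω := by positivity
  rw [norm_of_nonneg (by positivity)]
  exact inv_le_one_of_one_le₀ (by linarith)

/-- The tangent line inequality of the concave function `log (1 + a y)` of `a`. -/
theorem log_one_add_sub_le {y : ℝ} (hy : 0 ≤ y) (ha : 0 ≤ a) (hb : 0 ≤ b) :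
    Real.log (1 + b * y) - Real.log (1 + a * y) ≤ y / (1 + a * y) * (b - a) := by
  have h1 : 0 < 1 + a * y := by positivity
  have h2 : 0 < 1 + b * y := by positivity
  rw [← Real.log_div h2.ne' h1.ne']
  refine (Real.log_le_sub_one_of_pos (by positivity)).trans_eq ?_
  field_simp
  ring

theorem log_one_add_sub_lt {y : ℝ} (hy : 0 < y) (ha : 0 ≤ a) (hb : 0 ≤ b) (hab : a ≠ b) :
    Real.log (1 + b * y) - Real.log (1 + a * y) < y / (1 + a * y) * (b - a) := by
  have h1 : 0 < 1 + a * y := by positivity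
  have h2 : 0 < 1 + b * y := by positivity
  rw [← Real.log_div h2.ne' h1.ne']
  refine (Real.log_lt_sub_one_of_pos (by positivity) ?_).trans_eq ?_
  · rw [Ne, div_eq_one_iff_eq h1.ne']
    intro h
    exact hab (mul_right_cancel₀ hy.ne' (by linarith))
  · field_simp
    ring

theorem meanLog_sub_le (hx : Integrable x P) (hx0 : ∀ᵐ ω ∂P, 0 ≤ x ω) (hγ : 0 ≤ γ)
    (ha : 0 ≤ a) (hb : 0 ≤ b) :
    meanLog P x γ b - meanLog P x γ a ≤ marginal P x γ a * (b - a) := by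
  rw [meanLog, meanLog, marginal, ← integral_mul_const, ← integral_sub
    (integrable_log_one_add hx hx0 hγ hb) (integrable_log_one_add hx hx0 hγ ha)]
  refine integral_mono_ae ((integrable_log_one_add hx hx0 hγ hb).sub
    (integrable_log_one_add hx hx0 hγ ha)) ((integrable_marginal hx hx0 hγ ha).mul_const _) ?_
  filter_upwards [hx0] with ω h
  simp only [mul_assoc]
  exact log_one_add_sub_le (by positivity) ha hb

theorem integral_pos_of_ae_pos [NeZero P] {f : Ω → ℝ} (hf : Integrable f P)
    (h : ∀ᵐ ω ∂P, 0 < f ω) : 0 < ∫ ω, f ω ∂P := by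
  have h0 : 0 ≤ᵐ[P] f := h.mono fun ω hω => hω.le
  refine (integral_nonneg_of_ae h0).lt_of_ne' fun h1 => ?_
  have h2 := (integral_eq_zero_iff_of_nonneg_ae h0 hf).1 h1
  have h3 : ∀ᵐ ω ∂P, False := by
    filter_upwards [h, h2] with ω h4 h5
    exact h4.ne' h5
  exact NeZero.ne P (by simpa using h3)

theorem meanLog_sub_lt [NeZero P] (hx : Integrable x P) (hx0 : ∀ᵐ ω ∂P, 0 < x ω) (hγ : 0 < γ)
    (ha : 0 ≤ a) (hb : 0 ≤ b) (hab : a ≠ b) :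
    meanLog P x γ b - meanLog P x γ a < marginal P x γ a * (b - a) := by
  have hx1 : ∀ᵐ ω ∂P, 0 ≤ x ω := hx0.mono fun ω h => h.le
  have h1 := integrable_log_one_add hx hx1 hγ.le hb
  have h2 := integrable_log_one_add hx hx1 hγ.le ha
  have h3 := (integrable_marginal hx hx1 hγ.le ha).mul_const (b - a)
  have h4 : Integrable
      (fun ω => Real.log (1 + b * x ω * γ) - Real.log (1 + a * x ω * γ)) P := h1.sub h2
  rw [meanLog, meanLog, marginal, ← integral_mul_const, ← integral_sub h1 h2, ← sub_pos,
    ← integral_sub h3 h4]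
  refine integral_pos_of_ae_pos (h3.sub h4) ?_
  filter_upwards [hx0] with ω h
  rw [sub_pos]
  simp only [mul_assoc]
  exact log_one_add_sub_lt (by positivity) ha hb hab

theorem marginal_nonneg (hx0 : ∀ᵐ ω ∂P, 0 ≤ x ω) (hγ : 0 ≤ γ) (ha : 0 ≤ a) :
    0 ≤ marginal P x γ a := by
  refine integral_nonneg_of_ae ?_
  filter_upwards [hx0] with ω h
  simp only [Pi.zero_apply]
  positivity

theorem marginal_le (hx : Integrable x P) (hx0 : ∀ᵐ ω ∂P, 0 ≤ x ω) (hγ : 0 ≤ γ) (ha : 0 ≤ a) :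
    marginal P x γ a ≤ (∫ ω, x ω ∂P) * γ := by
  rw [marginal, ← integral_mul_const]
  refine integral_mono_ae (integrable_marginal hx hx0 hγ ha) (hx.mul_const γ) ?_
  filter_upwards [hx0] with ω h
  have h1 : 0 ≤ a * x ω * γ := by positivity
  exact div_le_self (by positivity) (by linarith)

/-- By the tangent line inequality the mean capacity is Lipschitz, since the marginal capacity is at
most `𝔼 x · γ`. -/
theorem continuousOn_meanLog (hx : Integrable x P) (hx0 : ∀ᵐ ω ∂P, 0 ≤ x ω) (hγ : 0 ≤ γ) :
    ContinuousOn (meanLog P x γ) (Ici 0) := by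
  have h : LipschitzOnWith (Real.toNNReal ((∫ ω, x ω ∂P) * γ)) (meanLog P x γ) (Ici 0) := by
    refine LipschitzOnWith.of_le_add_mul _ fun b hb a ha => ?_
    have h1 := meanLog_sub_le hx hx0 hγ ha hb
    have h2 := marginal_le hx hx0 hγ ha
    have h3 := marginal_nonneg hx0 hγ ha
    rw [Real.coe_toNNReal _ (h3.trans h2), Real.dist_eq]
    have h4 : marginal P x γ a * (b - a) ≤ (∫ ω, x ω ∂P) * γ * |b - a| :=
      (mul_le_mul_of_nonneg_left (le_abs_self _) h3).trans
        (mul_le_mul_of_nonneg_right h2 (abs_nonneg _))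
    linarith
  exact h.continuousOn

theorem continuousOn_marginal (hx : Integrable x P) (hx0 : ∀ᵐ ω ∂P, 0 ≤ x ω) (hγ : 0 ≤ γ) :
    ContinuousOn (marginal P x γ) (Ici 0) := by
  intro a ha
  refine tendsto_integral_filter_of_dominated_convergence (fun ω => x ω * γ) ?_ ?_
    (hx.mul_const γ) ?_
  · filter_upwards [self_mem_nhdsWithin] with b hb
    exact (integrable_marginal hx hx0 hγ hb).aestronglyMeasurable
  · filter_upwards [self_mem_nhdsWithin] with b hb
    filter_upwards [hx0] with ω h
    have hb : 0 ≤ b := hb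
    have h1 : 0 ≤ b * x ω * γ := by positivity
    rw [norm_of_nonneg (by positivity)]
    exact div_le_self (by positivity) (by linarith)
  · filter_upwards [hx0] with ω h
    have ha : 0 ≤ a := ha
    have h1 : 0 ≤ a * x ω * γ := by positivity
    have : ContinuousAt (fun b => x ω * γ / (1 + b * x ω * γ)) a :=
      ContinuousAt.div (by fun_prop) (by fun_prop) (by positivity)
    exact this.tendsto.mono_left inf_le_left

/-- Pointwise this is `a y / (1 + a y) = 1 - 1 / (1 + a y)`. -/
theorem mul_marginal [IsProbabilityMeasure P] (hx : Integrable x P) (hx0 : ∀ᵐ ω ∂P, 0 ≤ x ω)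
    (hγ : 0 ≤ γ) (ha : 0 ≤ a) : a * marginal P x γ a = 1 - invMean P x (a * γ) := by
  have h1 := integral_sub (integrable_const (μ := P) (1 : ℝ))
    (integrable_inv_one_add hx.aemeasurable hx0 (mul_nonneg ha hγ))
  rw [integral_const, probReal_univ, one_smul] at h1
  rw [marginal, invMean, ← integral_const_mul, ← h1]
  refine integral_congr_ae ?_
  filter_upwards [hx0] with ω h
  have h2 : 0 < 1 + a * x ω * γ := by positivity
  have h3 : 1 + a * γ * x ω = 1 + a * x ω * γ := by ring
  rw [h3]
  field_simp
  ring

theorem invMean_nonneg (hx0 : ∀ᵐ ω ∂P, 0 ≤ x ω) {t : ℝ} (ht : 0 ≤ t) : 0 ≤ invMean P x t := by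
  refine integral_nonneg_of_ae ?_
  filter_upwards [hx0] with ω h
  simp only [Pi.zero_apply]
  positivity

theorem invMean_pos [IsProbabilityMeasure P] (hx : AEMeasurable x P) (hx0 : ∀ᵐ ω ∂P, 0 ≤ x ω)
    {t : ℝ} (ht : 0 ≤ t) : 0 < invMean P x t := by
  refine integral_pos_of_ae_pos (integrable_inv_one_add hx hx0 ht) ?_
  filter_upwards [hx0] with ω h
  positivity

/-- Jensen's inequality for the mean capacity of a stream with unit power. -/
theorem neg_log_invMean_le_meanLog [IsProbabilityMeasure P] (hx : Integrable x P)
    (hx0 : ∀ᵐ ω ∂P, 0 ≤ x ω) (hγ : 0 ≤ γ) : -Real.log (invMean P x γ) ≤ meanLog P x γ 1 := by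
  have hφ := invMean_pos hx.aemeasurable hx0 hγ
  have hi := integrable_inv_one_add hx.aemeasurable hx0 hγ
  set φ := invMean P x γ with hφ'
  have hd : Integrable (fun ω => ((1 + γ * x ω)⁻¹ - φ) / φ) P :=
    (hi.sub (integrable_const φ)).div_const φ
  have h1 : ∫ ω, (-Real.log φ - ((1 + γ * x ω)⁻¹ - φ) / φ) ∂P = -Real.log φ := by
    rw [integral_sub (integrable_const _) hd, integral_div, integral_sub hi (integrable_const _)]
    change _ - (invMean P x γ - _) / φ = _
    simp [← hφ']
  rw [← h1]
  refine integral_mono_ae ((integrable_const _).sub hd)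
    (integrable_log_one_add hx hx0 hγ zero_le_one) ?_
  filter_upwards [hx0] with ω h
  have h2 : 0 < 1 + γ * x ω := by positivity
  have h3 := Real.log_le_sub_one_of_pos (show 0 < (1 + γ * x ω)⁻¹ / φ by positivity)
  rw [Real.log_div (by positivity) hφ.ne', Real.log_inv] at h3
  have h4 : 1 + 1 * x ω * γ = 1 + γ * x ω := by ring
  rw [h4]
  have h5 : ((1 + γ * x ω)⁻¹ - φ) / φ = (1 + γ * x ω)⁻¹ / φ - 1 := by field_simp
  linarith

end VBlast

/-! ### Maximizers of the total mean capacity -/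

namespace VBlast

theorem isCompact_allocations (m : ℕ) : IsCompact (allocations m) := by
  refine (isCompact_Icc (a := fun _ : Fin m => (0 : ℝ)) (b := fun _ => (m : ℝ))).of_isClosed_subset
    ?_ ?_
  · refine IsClosed.inter ?_ (isClosed_eq (by fun_prop) continuous_const)
    exact isClosed_le (f := fun _ : Fin m → ℝ => (0 : Fin m → ℝ)) continuous_const continuous_id
  · intro α hα
    refine ⟨hα.1, fun i => ?_⟩
    change α i ≤ m
    rw [← hα.2]
    exact Finset.single_le_sum (fun j _ => hα.1 j) (Finset.mem_univ i)

theorem one_mem_allocations (m : ℕ) : (fun _ => 1) ∈ allocations m :=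
  ⟨fun _ => zero_le_one, by simp⟩

variable {Ω : Type*} [MeasurableSpace Ω] {P : Measure Ω} {m : ℕ} {g : Fin m → Ω → ℝ} {γ : ℝ}
  {α β : Fin m → ℝ}

/-- The total mean capacity of streams with fixed random gains `g`. -/
def totalMeanLog (P : Measure Ω) (g : Fin m → Ω → ℝ) (γ : ℝ) (α : Fin m → ℝ) : ℝ :=
  ∑ i, meanLog P (g i) γ (α i)

theorem exists_isMaxOn_totalMeanLog (hg : ∀ i, Integrable (g i) P)
    (hg0 : ∀ i, ∀ᵐ ω ∂P, 0 ≤ g i ω) (hγ : 0 ≤ γ) :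
    ∃ α ∈ allocations m, IsMaxOn (totalMeanLog P g γ) (allocations m) α := by
  refine (isCompact_allocations m).exists_isMaxOn ⟨_, one_mem_allocations m⟩ ?_
  refine continuousOn_finsetSum _ fun i _ => ?_
  exact (continuousOn_meanLog (hg i) (hg0 i) hγ).comp (continuous_apply i).continuousOn
    fun α hα => hα.1 i

/-- Strict concavity: the tangent line inequalities at the midpoint of two maximizers. -/
theorem eq_of_isMaxOn_totalMeanLog [NeZero P] (hg : ∀ i, Integrable (g i) P)
    (hg0 : ∀ i, ∀ᵐ ω ∂P, 0 < g i ω) (hγ : 0 < γ) (hα : α ∈ allocations m)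
    (hαmax : IsMaxOn (totalMeanLog P g γ) (allocations m) α) (hβ : β ∈ allocations m)
    (hβmax : IsMaxOn (totalMeanLog P g γ) (allocations m) β) : α = β := by
  by_contra hne
  obtain ⟨k, hk⟩ := Function.ne_iff.1 hne
  let μ : Fin m → ℝ := fun i => (α i + β i) / 2
  have hμ0 : ∀ i, 0 ≤ μ i := fun i => by
    have := hα.1 i
    have := hβ.1 i
    simp only [μ]
    positivity
  have hμ : μ ∈ allocations m := by
    refine ⟨hμ0, ?_⟩
    simp only [μ]
    rw [← Finset.sum_div, Finset.sum_add_distrib, hα.2, hβ.2]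
    ring
  have hg1 : ∀ i, ∀ᵐ ω ∂P, 0 ≤ g i ω := fun i => (hg0 i).mono fun ω h => h.le
  have h1 : ∀ i, meanLog P (g i) γ (α i) + meanLog P (g i) γ (β i) ≤ 2 * meanLog P (g i) γ (μ i) := by
    intro i
    have h2 := meanLog_sub_le (hg i) (hg1 i) hγ.le (hμ0 i) (hα.1 i)
    have h3 := meanLog_sub_le (hg i) (hg1 i) hγ.le (hμ0 i) (hβ.1 i)
    have h4 : marginal P (g i) γ (μ i) * (α i - μ i) + marginal P (g i) γ (μ i) * (β i - μ i) = 0 := by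
      simp only [μ]; ring
    linarith
  have h2 : meanLog P (g k) γ (α k) + meanLog P (g k) γ (β k) < 2 * meanLog P (g k) γ (μ k) := by
    have hμk : μ k ≠ α k := by
      intro h
      simp only [μ] at h
      exact hk (by linarith)
    have h2 := meanLog_sub_lt (hg k) (hg0 k) hγ (hμ0 k) (hα.1 k) hμk
    have h3 := meanLog_sub_le (hg k) (hg1 k) hγ.le (hμ0 k) (hβ.1 k)
    have h4 : marginal P (g k) γ (μ k) * (α k - μ k) + marginal P (g k) γ (μ k) * (β k - μ k) = 0 := by
      simp only [μ]; ring
    linarith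
  have h3 : totalMeanLog P g γ α + totalMeanLog P g γ β < 2 * totalMeanLog P g γ μ := by
    rw [totalMeanLog, totalMeanLog, totalMeanLog, ← Finset.sum_add_distrib, Finset.mul_sum]
    exact Finset.sum_lt_sum (fun i _ => h1 i) ⟨k, Finset.mem_univ k, h2⟩
  have h4 : totalMeanLog P g γ μ ≤ totalMeanLog P g γ α := hαmax hμ
  have h5 : totalMeanLog P g γ μ ≤ totalMeanLog P g γ β := hβmax hμ
  linarith

/-- The first-order condition at a maximizer, by moving a little power from stream `i` to
stream `j`.  The tangent line inequality at the perturbed allocation makes differentiation of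
the capacity unnecessary. -/
theorem marginal_le_marginal_of_isMaxOn (hg : ∀ i, Integrable (g i) P)
    (hg0 : ∀ i, ∀ᵐ ω ∂P, 0 ≤ g i ω) (hγ : 0 ≤ γ) (hα : α ∈ allocations m)
    (hαmax : IsMaxOn (totalMeanLog P g γ) (allocations m) α) {i : Fin m} (hi : 0 < α i)
    (j : Fin m) : marginal P (g j) γ (α j) ≤ marginal P (g i) γ (α i) := by
  rcases eq_or_ne j i with rfl | hji
  · exact le_rfl
  have key : ∀ ε ∈ Ioc 0 (α i),
      marginal P (g j) γ (α j + ε) ≤ marginal P (g i) γ (α i - ε) := by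
    intro ε hε
    let β : Fin m → ℝ := fun k => α k + ε * ((if k = j then 1 else 0) - (if k = i then 1 else 0))
    have hβi : β i = α i - ε := by simp [β, hji.symm]; ring
    have hβj : β j = α j + ε := by simp [β, hji]
    have hβ : β ∈ allocations m := by
      constructor
      · intro k
        rcases eq_or_ne k i with rfl | hki
        · rw [hβi]; linarith [hε.2]
        · have h1 := hα.1 k
          have h2 := hε.1
          simp only [β, hki, if_false, sub_zero]
          split_ifs <;> linarith
      · simp only [β]
        rw [Finset.sum_add_distrib, hα.2, ← Finset.mul_sum, Finset.sum_sub_distrib]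
        simp
    have h1 : totalMeanLog P g γ β ≤ totalMeanLog P g γ α := hαmax hβ
    have h2 : totalMeanLog P g γ α - totalMeanLog P g γ β ≤
        ∑ k, marginal P (g k) γ (β k) * (α k - β k) := by
      rw [totalMeanLog, totalMeanLog, ← Finset.sum_sub_distrib]
      exact Finset.sum_le_sum fun k _ => meanLog_sub_le (hg k) (hg0 k) hγ (hβ.1 k) (hα.1 k)
    have h3 : ∑ k, marginal P (g k) γ (β k) * (α k - β k) =
        ε * (marginal P (g i) γ (β i) - marginal P (g j) γ (β j)) := by
      have e : ∀ k, marginal P (g k) γ (β k) * (α k - β k) =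
          (if k = i then ε * marginal P (g k) γ (β k) else 0) -
          (if k = j then ε * marginal P (g k) γ (β k) else 0) := by
        intro k
        have : α k - β k = ε * ((if k = i then 1 else 0) - (if k = j then 1 else 0)) := by
          simp only [β]; ring
        rw [this]
        split_ifs <;> ring
      rw [Finset.sum_congr rfl fun k _ => e k, Finset.sum_sub_distrib]
      simp
      ring
    rw [h3, hβi, hβj] at h2
    have h4 : 0 ≤ ε * (marginal P (g i) γ (α i - ε) - marginal P (g j) γ (α j + ε)) := by linarith
    have := nonneg_of_mul_nonneg_right h4 hε.1
    linarith
  have hαj : 0 ≤ α j := hα.1 j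
  have hj : Tendsto (fun ε => marginal P (g j) γ (α j + ε)) (𝓝[>] 0)
      (𝓝 (marginal P (g j) γ (α j))) := by
    refine ((continuousOn_marginal (hg j) (hg0 j) hγ) (α j) hαj).tendsto.comp
      (tendsto_nhdsWithin_iff.2 ⟨?_, ?_⟩)
    · have : Tendsto (fun ε : ℝ => α j + ε) (𝓝 0) (𝓝 (α j + 0)) :=
        (continuous_const.add continuous_id).tendsto 0
      rw [add_zero] at this
      exact this.mono_left inf_le_left
    · filter_upwards [self_mem_nhdsWithin] with ε hε
      have := mem_Ioi.1 hε
      exact mem_Ici.2 (by linarith)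
  have hlt : ∀ᶠ ε in 𝓝[>] (0 : ℝ), ε ∈ Ioc 0 (α i) := Ioc_mem_nhdsGT hi
  have hi' : Tendsto (fun ε => marginal P (g i) γ (α i - ε)) (𝓝[>] 0)
      (𝓝 (marginal P (g i) γ (α i))) := by
    refine ((continuousOn_marginal (hg i) (hg0 i) hγ) (α i) hi.le).tendsto.comp
      (tendsto_nhdsWithin_iff.2 ⟨?_, ?_⟩)
    · have : Tendsto (fun ε : ℝ => α i - ε) (𝓝 0) (𝓝 (α i - 0)) :=
        (continuous_const.sub continuous_id).tendsto 0
      rw [sub_zero] at this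
      exact this.mono_left inf_le_left
    · filter_upwards [hlt] with ε hε
      exact mem_Ici.2 (by linarith [hε.2])
  exact le_of_tendsto_of_tendsto hj hi' (hlt.mono key)

variable [IsProbabilityMeasure P]

/-- Some stream has at least unit power, hence marginal capacity at most one, and no other stream can
have a larger one. -/
theorem marginal_le_one_of_isMaxOn (hg : ∀ i, Integrable (g i) P)
    (hg0 : ∀ i, ∀ᵐ ω ∂P, 0 ≤ g i ω) (hγ : 0 ≤ γ) (hα : α ∈ allocations m)
    (hαmax : IsMaxOn (totalMeanLog P g γ) (allocations m) α) (i : Fin m) :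
    marginal P (g i) γ (α i) ≤ 1 := by
  obtain ⟨j, -, hj⟩ : ∃ j ∈ Finset.univ, (1 : ℝ) ≤ α j :=
    Finset.exists_le_of_sum_le ⟨i, Finset.mem_univ i⟩ (by simp [hα.2])
  refine (marginal_le_marginal_of_isMaxOn hg hg0 hγ hα hαmax (by linarith : 0 < α j) i).trans ?_
  have h1 := mul_marginal (hg j) (hg0 j) hγ (hα.1 j)
  have h2 := invMean_nonneg (P := P) (hg0 j) (mul_nonneg (hα.1 j) hγ)
  have h3 := marginal_nonneg (P := P) (hg0 j) hγ (hα.1 j)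
  nlinarith

/-- At zero power the marginal capacity is `𝔼 gᵢ · γ`, which may not exceed one at a maximizer. -/
theorem pos_of_isMaxOn (hg : ∀ i, Integrable (g i) P)
    (hg0 : ∀ i, ∀ᵐ ω ∂P, 0 ≤ g i ω) (hγ : 0 ≤ γ) (hα : α ∈ allocations m)
    (hαmax : IsMaxOn (totalMeanLog P g γ) (allocations m) α) {i : Fin m}
    (hi : 1 < (∫ ω, g i ω ∂P) * γ) : 0 < α i := by
  refine (hα.1 i).lt_of_ne fun h => ?_
  have h1 := marginal_le_one_of_isMaxOn hg hg0 hγ hα hαmax i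
  rw [← h, marginal] at h1
  simp only [zero_mul, add_zero, div_one] at h1
  rw [integral_mul_const] at h1
  linarith

/-- At an interior maximizer all marginal capacities agree; the power constraint determines their
common value. -/
theorem mul_one_sub_eq_of_isMaxOn (hg : ∀ i, Integrable (g i) P)
    (hg0 : ∀ i, ∀ᵐ ω ∂P, 0 ≤ g i ω) (hγ : 0 ≤ γ) (hα : α ∈ allocations m)
    (hαmax : IsMaxOn (totalMeanLog P g γ) (allocations m) α) (hpos : ∀ i, 0 < α i) (i : Fin m) :
    α i * (1 - (∑ j, invMean P (g j) (α j * γ)) / m) = 1 - invMean P (g i) (α i * γ) := by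
  have hm : (m : ℝ) ≠ 0 := Nat.cast_ne_zero.2 (by have := i.2; omega)
  have h1 : ∀ j, marginal P (g j) γ (α j) = marginal P (g i) γ (α i) := fun j =>
    le_antisymm (marginal_le_marginal_of_isMaxOn hg hg0 hγ hα hαmax (hpos i) j)
      (marginal_le_marginal_of_isMaxOn hg hg0 hγ hα hαmax (hpos j) i)
  have h2 : ∀ j, α j * marginal P (g i) γ (α i) = 1 - invMean P (g j) (α j * γ) := fun j => by
    rw [← h1 j, mul_marginal (hg j) (hg0 j) hγ (hα.1 j)]
  have h3 : (m : ℝ) * marginal P (g i) γ (α i) = m - ∑ j, invMean P (g j) (α j * γ) := by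
    rw [← hα.2, Finset.sum_mul, Finset.sum_congr rfl fun j _ => h2 j, Finset.sum_sub_distrib, hα.2]
    simp
  have h4 : marginal P (g i) γ (α i) = 1 - (∑ j, invMean P (g j) (α j * γ)) / m := by
    field_simp
    linarith
  rw [← h4, h2]

end VBlast

/-! ### High-SNR asymptotics of the maximizer -/

namespace VBlast

theorem tendsto_log_div_self : Tendsto (fun t : ℝ => Real.log t / t) atTop (𝓝 0) := by
  simpa using Real.tendsto_pow_log_div_mul_add_atTop 1 0 1 one_ne_zero

theorem tendsto_log_sq_div_self : Tendsto (fun t : ℝ => Real.log t ^ 2 / t) atTop (𝓝 0) := by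
  simpa using Real.tendsto_pow_log_div_mul_add_atTop 1 0 2 one_ne_zero

section Scalar

variable {φ : ℝ → ℝ} {c b : ℝ}

theorem tendsto_zero_of_mul_sub_log
    (hφ : Tendsto (fun t => t * φ t - (c * Real.log t + b)) atTop (𝓝 0)) :
    Tendsto φ atTop (𝓝 0) := by
  have h1 : Tendsto (fun t : ℝ => (t * φ t - (c * Real.log t + b)) * t⁻¹ +
      (c * (Real.log t / t) + b * t⁻¹)) atTop (𝓝 (0 * 0 + (c * 0 + b * 0))) :=
    (hφ.mul tendsto_inv_atTop_zero).add
      ((tendsto_log_div_self.const_mul c).add (tendsto_inv_atTop_zero.const_mul b))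
  simp only [mul_zero, add_zero] at h1
  refine h1.congr' ?_
  filter_upwards [eventually_gt_atTop 0] with t ht
  field_simp
  ring

theorem tendsto_mul_log_of_mul_sub_log
    (hφ : Tendsto (fun t => t * φ t - (c * Real.log t + b)) atTop (𝓝 0)) :
    Tendsto (fun t => φ t * Real.log t) atTop (𝓝 0) := by
  have h1 : Tendsto (fun t : ℝ => (t * φ t - (c * Real.log t + b)) * (Real.log t / t) +
      (c * (Real.log t ^ 2 / t) + b * (Real.log t / t))) atTop (𝓝 (0 * 0 + (c * 0 + b * 0))) :=
    (hφ.mul tendsto_log_div_self).add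
      ((tendsto_log_sq_div_self.const_mul c).add (tendsto_log_div_self.const_mul b))
  simp only [mul_zero, add_zero] at h1
  refine h1.congr' ?_
  filter_upwards [eventually_gt_atTop 0] with t ht
  field_simp
  ring

theorem eventually_log_mul_le_of_mul_sub_log
    (hφ : Tendsto (fun t => t * φ t - (c * Real.log t + b)) atTop (𝓝 0))
    (hpos : ∀ t, 0 ≤ t → 0 < φ t) {δ : ℝ} (hδ : 0 < δ) :
    ∀ᶠ t in atTop, Real.log (φ t) ≤ -(1 - δ) * Real.log t := by
  have hinv : Tendsto (fun t : ℝ => (t ^ δ)⁻¹) atTop (𝓝 0) :=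
    (tendsto_rpow_atTop hδ).inv_tendsto_atTop
  have hlog : Tendsto (fun t : ℝ => Real.log t / t ^ δ) atTop (𝓝 0) :=
    (isLittleO_log_rpow_atTop hδ).tendsto_div_nhds_zero
  have h1 : Tendsto (fun t : ℝ => (t * φ t - (c * Real.log t + b)) * (t ^ δ)⁻¹ +
      (c * (Real.log t / t ^ δ) + b * (t ^ δ)⁻¹)) atTop (𝓝 (0 * 0 + (c * 0 + b * 0))) :=
    (hφ.mul hinv).add ((hlog.const_mul c).add (hinv.const_mul b))
  simp only [mul_zero, add_zero] at h1
  filter_upwards [eventually_gt_atTop 0, h1.eventually_lt_const zero_lt_one] with t ht h2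
  have ht' : 0 < t ^ δ := by positivity
  have h3 : t * φ t < t ^ δ := by
    have : t * φ t = ((t * φ t - (c * Real.log t + b)) * (t ^ δ)⁻¹ +
      (c * (Real.log t / t ^ δ) + b * (t ^ δ)⁻¹)) * t ^ δ := by
      field_simp
      ring
    rw [this]
    exact mul_lt_of_lt_one_left ht' h2
  have h4 := Real.log_le_log (mul_pos ht (hpos t ht.le)) h3.le
  rw [Real.log_mul ht.ne' (hpos t ht.le).ne', Real.log_rpow ht] at h4
  linarith

end Scalar

/-- The allocation formula depends on its coefficients to first order in `1 / γ`. -/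
theorem tendsto_mul_allocationFormula_sub {m : ℕ} {A B : ℝ → Fin m → ℝ}
    (hAB : ∀ i, Tendsto (fun γ => A γ i - B γ i) atTop (𝓝 0))
    (hB : ∀ i, Tendsto (fun γ => B γ i / γ) atTop (𝓝 0)) (i : Fin m) :
    Tendsto (fun γ => γ * (allocationFormula γ (A γ) i - allocationFormula γ (B γ) i))
      atTop (𝓝 0) := by
  have hm : (m : ℝ) ≠ 0 := Nat.cast_ne_zero.2 (by have := i.2; omega)
  have hA : ∀ i, Tendsto (fun γ => A γ i / γ) atTop (𝓝 0) := fun i => by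
    have := ((hAB i).mul tendsto_inv_atTop_zero).add (hB i)
    simp only [mul_zero, add_zero] at this
    refine this.congr fun γ => ?_
    ring
  let D : (ℝ → Fin m → ℝ) → ℝ → ℝ := fun A γ => 1 - 1 / (m * γ) * ∑ j, A γ j
  have hD : ∀ A : ℝ → Fin m → ℝ, (∀ i, Tendsto (fun γ => A γ i / γ) atTop (𝓝 0)) →
      Tendsto (D A) atTop (𝓝 1) := by
    intro A hA
    have h1 : Tendsto (fun γ => 1 - (1 / (m : ℝ)) * ∑ j, A γ j / γ) atTop
        (𝓝 (1 - 1 / (m : ℝ) * ∑ _j : Fin m, 0)) :=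
      ((tendsto_finsetSum _ fun j _ => hA j).const_mul _).const_sub _
    simp only [Finset.sum_const_zero, mul_zero, sub_zero] at h1
    refine h1.congr fun γ => ?_
    simp only [D]
    rw [← Finset.sum_div]
    ring
  have hDA := hD A hA
  have hDB := hD B hB
  have h1 : Tendsto (fun γ => (-(A γ i - B γ i) * D B γ + (1 - B γ i / γ) *
      ((1 / (m : ℝ)) * ∑ j, (A γ j - B γ j))) / (D A γ * D B γ)) atTop
      (𝓝 ((-0 * 1 + (1 - 0) * ((1 / (m : ℝ)) * ∑ _j : Fin m, 0)) / (1 * 1))) :=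
    Tendsto.div (((hAB i).neg.mul hDB).add (((hB i).const_sub 1).mul
      ((tendsto_finsetSum _ fun j _ => hAB j).const_mul _))) (hDA.mul hDB) (by norm_num)
  simp only [Finset.sum_const_zero, mul_zero, neg_zero, zero_mul, add_zero, zero_div] at h1
  refine h1.congr' ?_
  filter_upwards [eventually_gt_atTop 0, hDA.eventually_ne one_ne_zero,
    hDB.eventually_ne one_ne_zero] with γ hγ h2 h3
  have e1 : γ * (D B γ - D A γ) = (1 / (m : ℝ)) * ∑ j, (A γ j - B γ j) := by
    simp only [D]
    rw [Finset.sum_sub_distrib]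
    field_simp
    ring
  have e2 : allocationFormula γ (A γ) i = (1 - A γ i / γ) / D A γ := rfl
  have e3 : allocationFormula γ (B γ) i = (1 - B γ i / γ) / D B γ := rfl
  rw [← e1, e2, e3, div_sub_div _ _ h2 h3]
  field_simp
  ring

variable {Ω : Type*} [MeasurableSpace Ω] {P : Measure Ω} [IsProbabilityMeasure P] {m : ℕ}
  {g : Fin m → Ω → ℝ} {α : ℝ → Fin m → ℝ}

theorem eventually_pos_of_isMaxOn (hg : ∀ i, Integrable (g i) P)
    (hg0 : ∀ i, ∀ᵐ ω ∂P, 0 < g i ω)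
    (hα : ∀ᶠ γ in atTop, α γ ∈ allocations m ∧
      IsMaxOn (totalMeanLog P g γ) (allocations m) (α γ)) :
    ∀ᶠ γ in atTop, ∀ i, 0 < α γ i := by
  refine eventually_all.2 fun i => ?_
  have h1 : 0 < ∫ ω, g i ω ∂P := integral_pos_of_ae_pos (hg i) (hg0 i)
  have h2 : Tendsto (fun γ => (∫ ω, g i ω ∂P) * γ) atTop atTop := tendsto_id.const_mul_atTop h1
  filter_upwards [hα, eventually_ge_atTop 0, h2.eventually_gt_atTop 1] with γ h3 h4 h5
  exact pos_of_isMaxOn hg (fun i => (hg0 i).mono fun ω h => h.le) h4 h3.1 h3.2 h5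

/-- If `αᵢ γ` stayed below `K`, the marginal capacity of stream `i` would be at least
`γ 𝔼 (gᵢ / (1 + K gᵢ))`, which eventually exceeds one. -/
theorem tendsto_mul_atTop_of_isMaxOn (hg : ∀ i, Integrable (g i) P)
    (hg0 : ∀ i, ∀ᵐ ω ∂P, 0 < g i ω)
    (hα : ∀ᶠ γ in atTop, α γ ∈ allocations m ∧
      IsMaxOn (totalMeanLog P g γ) (allocations m) (α γ)) (i : Fin m) :
    Tendsto (fun γ => α γ i * γ) atTop atTop := by
  refine tendsto_atTop.2 fun K' => ?_
  set K := max K' 0 with hK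
  have hK0 : 0 ≤ K := le_max_right _ _
  have hg1 : ∀ i, ∀ᵐ ω ∂P, 0 ≤ g i ω := fun i => (hg0 i).mono fun ω h => h.le
  have hint : Integrable (fun ω => g i ω * 1 / (1 + K * g i ω * 1)) P :=
    integrable_marginal (hg i) (hg1 i) zero_le_one hK0
  have h1 : 0 < ∫ ω, g i ω * 1 / (1 + K * g i ω * 1) ∂P := by
    refine integral_pos_of_ae_pos hint ?_
    filter_upwards [hg0 i] with ω h
    positivity
  have h2 : Tendsto (fun γ => (∫ ω, g i ω * 1 / (1 + K * g i ω * 1) ∂P) * γ) atTop atTop :=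
    tendsto_id.const_mul_atTop h1
  filter_upwards [hα, eventually_ge_atTop 0, h2.eventually_gt_atTop 1] with γ h3 h4 h5
  refine (le_max_left K' 0).trans ?_
  by_contra! hlt
  have h6 := marginal_le_one_of_isMaxOn hg hg1 h4 h3.1 h3.2 i
  refine absurd h6 (not_le.2 (h5.trans_le ?_))
  rw [marginal, ← integral_mul_const]
  refine integral_mono_ae (hint.mul_const γ) (integrable_marginal (hg i) (hg1 i) h4 (h3.1.1 i)) ?_
  filter_upwards [hg1 i] with ω h
  have h7 := h3.1.1 i
  have h8 : α γ i * γ * g i ω ≤ K * g i ω := mul_le_mul_of_nonneg_right hlt.le h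
  have h9 : 0 ≤ α γ i * g i ω * γ := by positivity
  rw [mul_one, mul_one, div_mul_eq_mul_div]
  refine div_le_div_of_nonneg_left (by positivity) (by positivity) ?_
  linarith

theorem eventually_mul_one_sub_eq_of_isMaxOn (hg : ∀ i, Integrable (g i) P)
    (hg0 : ∀ i, ∀ᵐ ω ∂P, 0 < g i ω)
    (hα : ∀ᶠ γ in atTop, α γ ∈ allocations m ∧
      IsMaxOn (totalMeanLog P g γ) (allocations m) (α γ)) :
    ∀ᶠ γ in atTop, ∀ i, α γ i * (1 - (∑ j, invMean P (g j) (α γ j * γ)) / m) =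
      1 - invMean P (g i) (α γ i * γ) := by
  filter_upwards [hα, eventually_ge_atTop 0, eventually_pos_of_isMaxOn hg hg0 hα] with γ h1 h2 h3 i
  exact mul_one_sub_eq_of_isMaxOn hg (fun i => (hg0 i).mono fun ω h => h.le) h2 h1.1 h1.2 h3 i

variable {c b : Fin m → ℝ}

theorem tendsto_one_of_isMaxOn (hg : ∀ i, Integrable (g i) P)
    (hg0 : ∀ i, ∀ᵐ ω ∂P, 0 < g i ω)
    (hasym : ∀ i, Tendsto (fun t => t * invMean P (g i) t - (c i * Real.log t + b i)) atTop (𝓝 0))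
    (hα : ∀ᶠ γ in atTop, α γ ∈ allocations m ∧
      IsMaxOn (totalMeanLog P g γ) (allocations m) (α γ)) (i : Fin m) :
    Tendsto (fun γ => α γ i) atTop (𝓝 1) := by
  have hφ : ∀ j, Tendsto (fun γ => invMean P (g j) (α γ j * γ)) atTop (𝓝 0) := fun j =>
    (tendsto_zero_of_mul_sub_log (hasym j)).comp (tendsto_mul_atTop_of_isMaxOn hg hg0 hα j)
  have hl : Tendsto (fun γ => 1 - (∑ j, invMean P (g j) (α γ j * γ)) / m) atTop (𝓝 1) := by
    have := ((tendsto_finsetSum Finset.univ fun j _ => hφ j).div_const (m : ℝ)).const_sub 1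
    simpa using this
  have h1 := ((hφ i).const_sub 1).div hl one_ne_zero
  rw [sub_zero, div_one] at h1
  refine h1.congr' ?_
  filter_upwards [eventually_mul_one_sub_eq_of_isMaxOn hg hg0 hα,
    hl.eventually_ne one_ne_zero] with γ h2 h3
  rw [Pi.div_apply, ← h2 i, mul_div_cancel_right₀ _ h3]

/-- The exact coefficients of the optimal allocation at SNR `γ`. -/
def exactCoeff (P : Measure Ω) (g : Fin m → Ω → ℝ) (γ : ℝ) (α : Fin m → ℝ) (i : Fin m) : ℝ :=
  γ * invMean P (g i) (α i * γ)

theorem eventually_eq_allocationFormula (hg : ∀ i, Integrable (g i) P)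
    (hg0 : ∀ i, ∀ᵐ ω ∂P, 0 < g i ω)
    (hasym : ∀ i, Tendsto (fun t => t * invMean P (g i) t - (c i * Real.log t + b i)) atTop (𝓝 0))
    (hα : ∀ᶠ γ in atTop, α γ ∈ allocations m ∧
      IsMaxOn (totalMeanLog P g γ) (allocations m) (α γ)) :
    ∀ᶠ γ in atTop, ∀ i, α γ i = allocationFormula γ (exactCoeff P g γ (α γ)) i := by
  have hφ : ∀ j, Tendsto (fun γ => invMean P (g j) (α γ j * γ)) atTop (𝓝 0) := fun j =>
    (tendsto_zero_of_mul_sub_log (hasym j)).comp (tendsto_mul_atTop_of_isMaxOn hg hg0 hα j)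
  have hl : Tendsto (fun γ => 1 - (∑ j, invMean P (g j) (α γ j * γ)) / m) atTop (𝓝 1) := by
    have := ((tendsto_finsetSum Finset.univ fun j _ => hφ j).div_const (m : ℝ)).const_sub 1
    simpa using this
  filter_upwards [eventually_mul_one_sub_eq_of_isMaxOn hg hg0 hα,
    hl.eventually_ne one_ne_zero, eventually_gt_atTop 0] with γ h2 h3 h4 i
  have hm : (m : ℝ) ≠ 0 := Nat.cast_ne_zero.2 (by have := i.2; omega)
  have e1 : 1 - 1 / (m * γ) * ∑ j, exactCoeff P g γ (α γ) j =
      1 - (∑ j, invMean P (g j) (α γ j * γ)) / m := by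
    simp only [exactCoeff]
    rw [← Finset.mul_sum]
    field_simp
  have e2 : 1 - exactCoeff P g γ (α γ) i / γ = 1 - invMean P (g i) (α γ i * γ) := by
    rw [exactCoeff, mul_div_cancel_left₀ _ h4.ne']
  rw [allocationFormula, e1, e2, ← h2 i, mul_div_cancel_right₀ _ h3]

/-- The optimal powers tend to one faster than `1 / log γ`, so that replacing the SNR `αᵢ γ` of
stream `i` by `γ` does not affect the limit of its coefficient. -/
theorem tendsto_exactCoeff_sub (hg : ∀ i, Integrable (g i) P)
    (hg0 : ∀ i, ∀ᵐ ω ∂P, 0 < g i ω)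
    (hasym : ∀ i, Tendsto (fun t => t * invMean P (g i) t - (c i * Real.log t + b i)) atTop (𝓝 0))
    (hα : ∀ᶠ γ in atTop, α γ ∈ allocations m ∧
      IsMaxOn (totalMeanLog P g γ) (allocations m) (α γ)) (i : Fin m) :
    Tendsto (fun γ => exactCoeff P g γ (α γ) i - (c i * Real.log γ + b i)) atTop (𝓝 0) := by
  have ht := tendsto_mul_atTop_of_isMaxOn hg hg0 hα
  have h1 := tendsto_one_of_isMaxOn hg hg0 hasym hα
  have hφ : ∀ j, Tendsto (fun γ => invMean P (g j) (α γ j * γ)) atTop (𝓝 0) := fun j =>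
    (tendsto_zero_of_mul_sub_log (hasym j)).comp (ht j)
  have hlogα : ∀ j, Tendsto (fun γ => Real.log (α γ j)) atTop (𝓝 0) := fun j => by
    simpa using (h1 j).log one_ne_zero
  have hpos := eventually_pos_of_isMaxOn hg hg0 hα
  have hφlog : ∀ j, Tendsto (fun γ => invMean P (g j) (α γ j * γ) * Real.log γ) atTop (𝓝 0) := by
    intro j
    have h2 := ((tendsto_mul_log_of_mul_sub_log (hasym j)).comp (ht j)).sub ((hφ j).mul (hlogα j))
    rw [mul_zero, sub_zero] at h2
    refine h2.congr' ?_
    filter_upwards [hpos, eventually_gt_atTop 0] with γ h3 h4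
    rw [Function.comp_apply, Real.log_mul (h3 j).ne' h4.ne']
    ring
  have hinv : Tendsto (fun γ => ((α γ i)⁻¹ - 1) * Real.log γ) atTop (𝓝 0) := by
    have h2 : Tendsto (fun γ => (invMean P (g i) (α γ i * γ) * Real.log γ -
        (∑ j, invMean P (g j) (α γ j * γ) * Real.log γ) / m) /
        (1 - invMean P (g i) (α γ i * γ))) atTop (𝓝 ((0 - (∑ _j : Fin m, 0) / m) / (1 - 0))) :=
      ((hφlog i).sub ((tendsto_finsetSum _ fun j _ => hφlog j).div_const _)).div
        ((hφ i).const_sub 1) (by norm_num)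
    simp only [Finset.sum_const_zero, zero_div, sub_zero] at h2
    refine h2.congr' ?_
    filter_upwards [eventually_mul_one_sub_eq_of_isMaxOn hg hg0 hα, hpos,
      (hφ i).eventually_lt_const one_pos] with γ h3 h4 h5
    have h6 : 1 - invMean P (g i) (α γ i * γ) ≠ 0 := by linarith
    have h7 := h4 i
    have h8 : (α γ i)⁻¹ = (1 - (∑ j, invMean P (g j) (α γ j * γ)) / m) /
        (1 - invMean P (g i) (α γ i * γ)) := by
      rw [eq_div_iff h6, ← h3 i, inv_mul_cancel_left₀ h7.ne']
    rw [h8, ← Finset.sum_mul]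
    field_simp
    ring
  have hα' : Tendsto (fun γ => (α γ i)⁻¹) atTop (𝓝 1) := by
    simpa using (h1 i).inv₀ one_ne_zero
  have h2 : Tendsto (fun γ => c i * (((α γ i)⁻¹ - 1) * Real.log γ) + ((α γ i)⁻¹ - 1) * b i +
      c i * ((α γ i)⁻¹ * Real.log (α γ i)) +
      (α γ i)⁻¹ * (α γ i * γ * invMean P (g i) (α γ i * γ) - (c i * Real.log (α γ i * γ) + b i)))
      atTop (𝓝 (c i * 0 + (1 - 1) * b i + c i * (1 * 0) + 1 * 0)) :=
    (((hinv.const_mul _).add ((hα'.sub_const 1).mul_const _)).add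
      ((hα'.mul (hlogα i)).const_mul _)).add (hα'.mul ((hasym i).comp (ht i)))
  simp only [mul_zero, sub_self, zero_mul, add_zero] at h2
  refine h2.congr' ?_
  filter_upwards [hpos, eventually_gt_atTop 0] with γ h3 h4
  have h5 := h3 i
  rw [exactCoeff, Real.log_mul h5.ne' h4.ne']
  field_simp
  ring

/-- By concavity the difference is at most `∑ᵢ fᵢ (αᵢ - 1)`, where the marginal capacities `fᵢ` at unit
power are at most one. -/
theorem tendsto_totalMeanLog_sub (hg : ∀ i, Integrable (g i) P)
    (hg0 : ∀ i, ∀ᵐ ω ∂P, 0 < g i ω)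
    (hasym : ∀ i, Tendsto (fun t => t * invMean P (g i) t - (c i * Real.log t + b i)) atTop (𝓝 0))
    (hα : ∀ᶠ γ in atTop, α γ ∈ allocations m ∧
      IsMaxOn (totalMeanLog P g γ) (allocations m) (α γ)) :
    Tendsto (fun γ => totalMeanLog P g γ (α γ) - totalMeanLog P g γ fun _ => 1) atTop (𝓝 0) := by
  have hg1 : ∀ i, ∀ᵐ ω ∂P, 0 ≤ g i ω := fun i => (hg0 i).mono fun ω h => h.le
  have h1 : Tendsto (fun γ => ∑ i, |α γ i - 1|) atTop (𝓝 (∑ _i : Fin m, |(1 : ℝ) - 1|)) :=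
    tendsto_finsetSum _ fun i _ => ((tendsto_one_of_isMaxOn hg hg0 hasym hα i).sub_const 1).abs
  simp only [sub_self, abs_zero, Finset.sum_const_zero] at h1
  refine squeeze_zero' ?_ ?_ h1
  · filter_upwards [hα] with γ h2
    exact sub_nonneg.2 (h2.2 (one_mem_allocations m))
  · filter_upwards [hα, eventually_ge_atTop 0] with γ h2 h3
    rw [totalMeanLog, totalMeanLog, ← Finset.sum_sub_distrib]
    refine Finset.sum_le_sum fun i _ => ?_
    refine (meanLog_sub_le (hg i) (hg1 i) h3 zero_le_one (h2.1.1 i)).trans ?_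
    have h4 := mul_marginal (hg i) (hg1 i) h3 zero_le_one
    have h5 := invMean_nonneg (P := P) (hg1 i) (mul_nonneg zero_le_one h3)
    have h6 := marginal_nonneg (P := P) (hg1 i) h3 zero_le_one
    calc marginal P (g i) γ 1 * (α γ i - 1) ≤ marginal P (g i) γ 1 * |α γ i - 1| :=
          mul_le_mul_of_nonneg_left (le_abs_self _) h6
      _ ≤ 1 * |α γ i - 1| := mul_le_mul_of_nonneg_right (by linarith) (abs_nonneg _)
      _ = _ := one_mul _

/-- The capacity `-log (φ γ)` that Jensen's inequality guarantees is `log γ - log (γ φ γ)`, and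
`γ φ γ` grows at most logarithmically. -/
theorem eventually_le_totalMeanLog_one (hg : ∀ i, Integrable (g i) P)
    (hg0 : ∀ i, ∀ᵐ ω ∂P, 0 ≤ g i ω)
    (hasym : ∀ i, Tendsto (fun t => t * invMean P (g i) t - (c i * Real.log t + b i)) atTop (𝓝 0))
    {δ : ℝ} (hδ : 0 < δ) :
    ∀ᶠ γ in atTop, m * ((1 - δ) * Real.log γ) ≤ totalMeanLog P g γ fun _ => 1 := by
  have h1 : ∀ᶠ γ in atTop, ∀ i, Real.log (invMean P (g i) γ) ≤ -(1 - δ) * Real.log γ :=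
    eventually_all.2 fun i => eventually_log_mul_le_of_mul_sub_log (hasym i)
      (fun t ht => invMean_pos (hg i).aemeasurable (hg0 i) ht) hδ
  filter_upwards [h1, eventually_ge_atTop 0] with γ h2 h3
  calc m * ((1 - δ) * Real.log γ) = ∑ _i : Fin m, (1 - δ) * Real.log γ := by simp
    _ ≤ _ := Finset.sum_le_sum fun i _ => by
      have := neg_log_invMean_le_meanLog (hg i) (hg0 i) h3
      linarith [h2 i]

end VBlast

/-! ### The channel capacity -/

namespace VBlast

variable {Ω : Type*} [MeasurableSpace Ω] {P : Measure Ω} {n m : ℕ}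
  {H : Ω → Matrix (Fin n) (Fin m) ℂ}

theorem meanCapacity_activeStreams {α : Fin m → ℝ} (hα : ∀ i, 0 < α i) (γ : ℝ) :
    meanCapacity P H activeStreams γ α = totalMeanLog P (fun i ω => gain (H ω) univ i) γ α := by
  have h : activeStreams α = univ := eq_univ_of_forall hα
  rw [meanCapacity, h]
  rfl

variable [IsProbabilityMeasure P]

/-- The coefficient of `log γ` in `approxCoeff`. -/
def approxSlope (n : ℕ) (i : Fin m) : ℝ := if n + ((i : ℕ) + 1) = m + 1 then 1 else 0

/-- The constant term of `approxCoeff`. -/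
def approxIntercept (n : ℕ) (i : Fin m) : ℝ :=
  if n + ((i : ℕ) + 1) = m + 1 then -Real.eulerMascheroniConstant
  else 1 / ((n : ℝ) - m + ((i : ℕ) + 1) - 1)

theorem approxCoeff_eq (γ : ℝ) (i : Fin m) :
    approxCoeff n γ i = approxSlope n i * Real.log γ + approxIntercept n i := by
  rw [approxCoeff, approxSlope, approxIntercept]
  split_ifs <;> ring

theorem IsIIDRayleigh.tendsto_mul_invMean_sub (hH : IsIIDRayleigh P H) (hnm : m ≤ n) (i : Fin m) :
    Tendsto (fun t => t * invMean P (fun ω => gain (H ω) univ i) t -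
      (approxSlope n i * Real.log t + approxIntercept n i)) atTop (𝓝 0) := by
  have h1 : (fun t => t * gammaInvMean (n - m + i + 1) t -
      (approxSlope n i * Real.log t + approxIntercept n i)) =ᶠ[atTop]
      fun t => t * invMean P (fun ω => gain (H ω) univ i) t -
        (approxSlope n i * Real.log t + approxIntercept n i) := by
    filter_upwards [eventually_ge_atTop 0] with t ht
    rw [invMean, hH.integral_inv_one_add_mul_gain hnm i ht]
  refine Tendsto.congr' h1 ?_
  by_cases hd : n + ((i : ℕ) + 1) = m + 1
  · have hd' : n - m + (i : ℕ) + 1 = 1 := by omega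
    have h2 := tendsto_mul_gammaInvMean_one.add_const Real.eulerMascheroniConstant
    rw [neg_add_cancel] at h2
    rw [hd']
    refine h2.congr fun t => ?_
    rw [approxSlope, approxIntercept, if_pos hd, if_pos hd]
    ring
  · obtain ⟨k, hk⟩ : ∃ k, n - m + (i : ℕ) = k + 1 := Nat.exists_eq_succ_of_ne_zero (by omega)
    have hk' : (n : ℝ) - m + ((i : ℕ) + 1) - 1 = k + 1 := by
      have : ((n - m + (i : ℕ) : ℕ) : ℝ) = ((k + 1 : ℕ) : ℝ) := by rw [hk]
      push_cast [Nat.cast_sub hnm] at this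
      linarith
    have h2 := (tendsto_mul_gammaInvMean_add_two k).sub_const (1 / ((k : ℝ) + 1))
    rw [sub_self] at h2
    rw [hk]
    refine h2.congr fun t => ?_
    rw [approxSlope, approxIntercept, if_neg hd, if_neg hd, hk']
    ring

/-- Turning a stream off loses one of the `m` terms `log γ` of the capacity, and nulling out less
interference gains only a bounded amount. -/
theorem IsIIDRayleigh.exists_meanCapacity_le (hH : IsIIDRayleigh P H) :
    ∃ K : ℝ, ∀ γ : ℝ, 1 ≤ γ → ∀ α ∈ allocations m, (∃ i, α i = 0) →
      ∀ N : (Fin m → ℝ) → Set (Fin m), meanCapacity P H N γ α ≤ (m - 1) * Real.log γ + K := by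
  let E : Set (Fin m) → Fin m → ℝ := fun S i => ∫ ω, gain (H ω) S i ∂P
  have hE : ∀ S i, 0 ≤ E S i := fun S i => integral_nonneg fun ω => gain_nonneg _ _ _
  refine ⟨∑ S, ∑ i, m * E S i, fun γ hγ α hα ⟨k, hk⟩ N => ?_⟩
  have hlogγ : 0 ≤ Real.log γ := Real.log_nonneg hγ
  have h1 : ∀ i, ∫ ω, streamCapacity (H ω) (N α) γ α i ∂P ≤
      (if i = k then 0 else Real.log γ) + m * E (N α) i := by
    intro i
    have hαi := hα.1 i
    have hαm : α i ≤ m := by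
      rw [← hα.2]
      exact Finset.single_le_sum (fun j _ => hα.1 j) (Finset.mem_univ i)
    have hm0 : (0 : ℝ) ≤ m := Nat.cast_nonneg m
    split_ifs with hik
    · rw [hik]
      simp only [streamCapacity, hk, zero_mul, add_zero, Real.log_one, integral_zero, zero_add]
      exact mul_nonneg hm0 (hE _ _)
    · have hg := hH.integrable_gain (N α) i
      have h2 : ∫ ω, (Real.log γ + m * gain (H ω) (N α) i) ∂P = Real.log γ + m * E (N α) i := by
        rw [integral_add (integrable_const _) (hg.const_mul _), integral_const_mul]
        simp [E]
      rw [← h2]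
      refine integral_mono (integrable_log_one_add hg (.of_forall fun ω => gain_nonneg _ _ _)
        (by linarith) hαi) ((integrable_const _).add (hg.const_mul _)) fun ω => ?_
      have h3 := gain_nonneg (H ω) (N α) i
      have h4 : 0 ≤ m * gain (H ω) (N α) i := by positivity
      have h5 : 1 + α i * gain (H ω) (N α) i * γ ≤ γ * (1 + m * gain (H ω) (N α) i) := by
        have := mul_le_mul_of_nonneg_right (mul_le_mul_of_nonneg_right hαm h3)
          (zero_le_one.trans hγ)
        linarith
      have h6 : 0 ≤ α i * gain (H ω) (N α) i * γ := by positivity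
      have h7 := Real.log_le_log (by linarith) h5
      rw [Real.log_mul (by positivity) (by positivity)] at h7
      have h8 := Real.log_le_sub_one_of_pos (show 0 < 1 + m * gain (H ω) (N α) i by linarith)
      simp only [streamCapacity]
      linarith
  have h2 : ∑ i, (if i = k then 0 else Real.log γ) = (m - 1) * Real.log γ := by
    have : ∀ i, (if i = k then 0 else Real.log γ) =
        Real.log γ - (if i = k then Real.log γ else 0) := fun i => by split_ifs <;> ring
    simp only [this, Finset.sum_sub_distrib]
    simp
    ring
  calc meanCapacity P H N γ α ≤ ∑ i, ((if i = k then 0 else Real.log γ) + m * E (N α) i) :=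
        Finset.sum_le_sum fun i _ => h1 i
    _ = (m - 1) * Real.log γ + ∑ i, m * E (N α) i := by rw [Finset.sum_add_distrib, h2]
    _ ≤ _ := by
        gcongr
        exact Finset.single_le_sum (f := fun S => ∑ i, m * E S i) (fun S _ =>
          Finset.sum_nonneg fun i _ => mul_nonneg (Nat.cast_nonneg m) (hE S i)) (Finset.mem_univ _)

theorem IsIIDRayleigh.eventually_meanCapacity_lt (hH : IsIIDRayleigh P H) (hm : 1 ≤ m)
    (hnm : m ≤ n) : ∀ᶠ γ in atTop, ∀ α ∈ allocations m, (∃ i, α i = 0) →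
      ∀ N : (Fin m → ℝ) → Set (Fin m), meanCapacity P H N γ α <
        totalMeanLog P (fun i ω => gain (H ω) univ i) γ fun _ => 1 := by
  obtain ⟨K, hK⟩ := hH.exists_meanCapacity_le
  have hm' : (0 : ℝ) < m := by exact_mod_cast hm
  filter_upwards [eventually_ge_atTop 1, Real.tendsto_log_atTop.eventually_gt_atTop (2 * K),
    eventually_le_totalMeanLog_one (fun i => hH.integrable_gain univ i)
      (fun i => .of_forall fun ω => gain_nonneg _ _ _) (hH.tendsto_mul_invMean_sub hnm)
      (δ := 1 / (2 * m)) (by positivity)] with γ h1 h2 h3 α hα hα0 N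
  refine (hK γ h1 α hα hα0 N).trans_lt (lt_of_lt_of_le ?_ h3)
  have : (m : ℝ) * ((1 - 1 / (2 * m)) * Real.log γ) = (m - 1) * Real.log γ + Real.log γ / 2 := by
    field_simp
    ring
  rw [this]
  linarith

end VBlast

end

theorem theorem6 {Ω : Type*} [MeasurableSpace Ω] (P : Measure Ω) [IsProbabilityMeasure P]
    {n m : ℕ} (hm : 1 ≤ m) (hnm : m ≤ n) (H : Ω → Matrix (Fin n) (Fin m) ℂ)
    (hH : VBlast.IsIIDRayleigh P H) :
    -- the mean capacities are expectations of integrable random variables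
    (∀ (S : Set (Fin m)) (γ₀ : ℝ), 0 ≤ γ₀ → ∀ α ∈ VBlast.allocations m, ∀ i,
      Integrable (fun ω => VBlast.streamCapacity (H ω) S γ₀ α i) P) ∧
    ∃ αopt : ℝ → Fin m → ℝ,
      -- at high SNR the optimum exists and is unique, with or without recalculation of the gains
      -- when streams are turned off
      (∀ᶠ γ₀ in atTop, ∀ α : Fin m → ℝ,
        (VBlast.IsOptimal P H VBlast.allStreams γ₀ α ↔ α = αopt γ₀) ∧
        (VBlast.IsOptimal P H VBlast.activeStreams γ₀ α ↔ α = αopt γ₀)) ∧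
      -- it is given by the formula, with coefficients that approach the stated ones
      (∃ A : ℝ → Fin m → ℝ,
        (∀ᶠ γ₀ in atTop, ∀ i, αopt γ₀ i = VBlast.allocationFormula γ₀ (A γ₀) i) ∧
        ∀ i, Tendsto (fun γ₀ => A γ₀ i - VBlast.approxCoeff n γ₀ i) atTop (𝓝 0)) ∧
      -- so the formula with the stated coefficients is correct to first order in `1 / γ₀`
      (∀ i, (fun γ₀ => αopt γ₀ i -
          VBlast.allocationFormula γ₀ (VBlast.approxCoeff n γ₀) i) =o[atTop]
        (fun γ₀ : ℝ => 1 / γ₀)) ∧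
      -- uniform allocation is asymptotically optimal
      (∀ i, Tendsto (fun γ₀ => αopt γ₀ i) atTop (𝓝 1)) ∧
      Tendsto (fun γ₀ => VBlast.meanCapacity P H VBlast.activeStreams γ₀ (αopt γ₀) -
        VBlast.meanCapacity P H VBlast.activeStreams γ₀ (fun _ => 1)) atTop (𝓝 0) := by
  open VBlast in
  set g : Fin m → Ω → ℝ := fun i ω => gain (H ω) univ i with hgdef
  have hg : ∀ i, Integrable (g i) P := fun i => hH.integrable_gain univ i
  have hg0 : ∀ i, ∀ᵐ ω ∂P, 0 < g i ω := fun i => hH.ae_gain_pos hnm i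
  have hg1 : ∀ i, ∀ᵐ ω ∂P, 0 ≤ g i ω := fun i => (hg0 i).mono fun ω h => h.le
  have hasym := hH.tendsto_mul_invMean_sub hnm
  refine ⟨fun S γ hγ α hα i => integrable_log_one_add (hH.integrable_gain S i)
    (.of_forall fun ω => gain_nonneg _ _ _) hγ (hα.1 i), ?_⟩
  have hex : ∀ γ : ℝ, ∃ α : Fin m → ℝ, 0 ≤ γ → α ∈ allocations m ∧
      IsMaxOn (totalMeanLog P g γ) (allocations m) α := by
    intro γ
    by_cases hγ : 0 ≤ γ
    · obtain ⟨α, h⟩ := exists_isMaxOn_totalMeanLog hg hg1 hγ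
      exact ⟨α, fun _ => h⟩
    · exact ⟨0, fun h => absurd h hγ⟩
  -- at negative SNR the chosen value is arbitrary
  choose αopt hopt using hex
  have hα : ∀ᶠ γ in atTop, αopt γ ∈ allocations m ∧
      IsMaxOn (totalMeanLog P g γ) (allocations m) (αopt γ) :=
    (eventually_ge_atTop 0).mono hopt
  have hpos := eventually_pos_of_isMaxOn hg hg0 hα
  have hformula := eventually_eq_allocationFormula hg hg0 hasym hα
  have hcoeff : ∀ i, Tendsto (fun γ => exactCoeff P g γ (αopt γ) i - approxCoeff n γ i)
      atTop (𝓝 0) := fun i => by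
    simpa only [approxCoeff_eq] using tendsto_exactCoeff_sub hg hg0 hasym hα i
  refine ⟨αopt, ?_, ⟨fun γ => exactCoeff P g γ (αopt γ), hformula, hcoeff⟩, fun i => ?_,
    tendsto_one_of_isMaxOn hg hg0 hasym hα, ?_⟩
  · filter_upwards [hα, hpos, hH.eventually_meanCapacity_lt hm hnm, eventually_gt_atTop 0]
      with γ h1 h2 h3 h4 α
    have hone : meanCapacity P H activeStreams γ (fun _ => 1) = totalMeanLog P g γ fun _ => 1 :=
      meanCapacity_activeStreams (fun _ => zero_lt_one) γ
    have hzero : ∀ β ∈ allocations m, (¬∀ i, 0 < β i) →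
        meanCapacity P H activeStreams γ β < totalMeanLog P g γ fun _ => 1 := by
      intro β hβ hβ0
      obtain ⟨i, hi⟩ := not_forall.1 hβ0
      exact h3 β hβ ⟨i, le_antisymm (not_lt.1 hi) (hβ.1 i)⟩ activeStreams
    constructor
    · constructor
      · exact fun h => eq_of_isMaxOn_totalMeanLog hg hg0 h4 h.1 h.2 h1.1 h1.2
      · rintro rfl
        exact h1
    · constructor
      · rintro ⟨hαm, hmax⟩
        have hαpos : ∀ i, 0 < α i := by
          by_contra h
          have h5 : meanCapacity P H activeStreams γ (fun _ => 1) ≤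
            meanCapacity P H activeStreams γ α := hmax (one_mem_allocations m)
          have h6 := hzero α hαm h
          linarith
        refine eq_of_isMaxOn_totalMeanLog hg hg0 h4 hαm (fun β hβ => ?_) h1.1 h1.2
        have h5 : meanCapacity P H activeStreams γ (αopt γ) ≤
          meanCapacity P H activeStreams γ α := hmax h1.1
        rw [meanCapacity_activeStreams h2, meanCapacity_activeStreams hαpos] at h5
        exact le_trans (h1.2 hβ) h5
      · rintro rfl
        refine ⟨h1.1, fun β hβ => ?_⟩
        change meanCapacity P H activeStreams γ β ≤ meanCapacity P H activeStreams γ (αopt γ)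
        rw [meanCapacity_activeStreams h2]
        by_cases hβpos : ∀ i, 0 < β i
        · rw [meanCapacity_activeStreams hβpos]
          exact h1.2 hβ
        · exact (hzero β hβ hβpos).le.trans (h1.2 (one_mem_allocations m))
  · have hB : ∀ i : Fin m, Tendsto (fun γ => approxCoeff n γ i / γ) atTop (𝓝 0) := fun i => by
      have := (tendsto_log_div_self.const_mul (approxSlope n i)).add
        (tendsto_inv_atTop_zero.const_mul (approxIntercept n i))
      simp only [mul_zero, add_zero] at this
      refine this.congr fun γ => ?_
      rw [approxCoeff_eq]
      ring
    rw [isLittleO_iff_tendsto' ((eventually_gt_atTop 0).mono fun γ hγ h =>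
      absurd h (by positivity))]
    refine (tendsto_mul_allocationFormula_sub hcoeff hB i).congr' ?_
    filter_upwards [hformula] with γ h
    rw [h i, div_div_eq_mul_div, div_one, mul_comm]
  · refine (tendsto_totalMeanLog_sub hg hg0 hasym hα).congr' ?_
    filter_upwards [hpos] with γ h
    rw [meanCapacity_activeStreams h, meanCapacity_activeStreams fun _ => zero_lt_one]
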